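/- Let $n\ge2$, let $\mathbf B^n=\{x\in\mathbb R^n:|x|<1\}$ be the open unit ball, and let $d\sigma$ be the normalized surface measure on the unit sphere $\partial\mathbf B^n$, with $\|\cdot\|_{\partial\mathbf B^n}$ the norm of $L^2(\partial\mathbf B^n,d\sigma)$. Every (complex-valued) harmonic function $f$ on $\mathbf B^n$ has a unique decomposition $f=\sum_{p=0}^\infty f_p$, converging uniformly on compact subsets of $\mathbf B^n$, where $f_p$ is a harmonic polynomial on $\mathbb R^n$ homogeneous of degree $p$. Put $$\|f\|_\square^2:=\sum_{p=0}^\infty p\,\frac{(n/2)_p}{p!}\,\|f_p\|^2_{\partial\mathbf B^n}\in[0,\infty],\qquad (x)_p:=x(x+1)\cdots(x+p-1),$$ and let the harmonic Dirichlet space $\mathcal H_\square$ be the set of all harmonic $f$ on $\mathbf B^n$ with $\|f\|_\square<\infty$. For $s>-1$ let $\|\cdot\|_s$ be the norm of $L^2(\mathbf B^n,d\rho_s)$, where $$d\rho_s(x)=\frac{\Gamma(\frac n2+s+1)}{\pi^{n/2}\,\Gamma(s+1)}(1-|x|^2)^s\,dx.$$ Let $\mathcal X_1,\dots,\mathcal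 X_{n(n-1)}$ be the vector fields $X_{jk}=x_j\partial_k-x_k\partial_j$, $1\le j,k\le n$, $j\ne k$, in some order, and for an integer $m>\frac n4$ (so that $2m-\frac n2-1>-1$) put $$S_m(f):=\sum_{j_1,\dots,j_m=1}^{n(n-1)}\|\mathcal X_{j_1}\cdots\mathcal X_{j_m}f\|^2_{2m-\frac n2-1}\in[0,\infty].$$ Theorem. For every harmonic function $f$ on $\mathbf B^n$, the following are equivalent: (i) $f\in\mathcal H_\square$; (ii) $S_m(f)<\infty$ for some integer $m>\frac n4$; (iii) $S_m(f)<\infty$ for every integer $m>\frac n4$. Furthermore, $\mathcal H_\square$ is a complex vector space, $\|\cdot\|_\square$ is a seminorm on it, and for every integer $m>\frac n4$ the function $f\mapsto S_m(f)^{1/2}$ is a seminorm on $\mathcal H_\square$ equivalent to $\|\cdot\|_\square$: there are constants $c,C>0$ depending only on $n$ and $m$ such that $c\,\|f\|_\square\le S_m(f)^{1/2}\le C\,\|f\|_\square$ for all $f\in\mathcal H_\square$. -/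

import Mathlib

open MeasureTheory Metric Filter Topology InnerProductSpace
open scoped ENNReal Nat

noncomputable section

namespace HarmonicDirichlet

/-- Real Euclidean space `ℝⁿ`. -/
abbrev E (n : ℕ) : Type := EuclideanSpace ℝ (Fin n)

/-- The function `g` on `ℝⁿ` is a harmonic polynomial (with complex coefficients),
homogeneous of degree `p`. -/
def IsSolidHarmonic (n p : ℕ) (g : E n → ℂ) : Prop :=
  (∃ P : MvPolynomial (Fin n) ℂ, P.IsHomogeneous p ∧
    ∀ x : E n, g x = MvPolynomial.eval (fun i => (x i : ℂ)) P) ∧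
  HarmonicOnNhd g Set.univ

/-- `f = ∑ₚ F p` on the open unit ball, where `F p` is a harmonic polynomial homogeneous of
degree `p` and the sum converges uniformly on compact subsets of the ball. -/
structure IsHarmonicExpansion (n : ℕ) (f : E n → ℂ) (F : ℕ → E n → ℂ) : Prop where
  solid : ∀ p, IsSolidHarmonic n p (F p)
  tendsto : TendstoLocallyUniformlyOn (fun (N : ℕ) (x : E n) => ∑ p ∈ Finset.range N, F p x) f
    atTop (ball (0 : E n) 1)

/-- The components `f_p` in the (unique) decomposition `f = ∑ₚ f_p` of a function that is harmonic
on the unit ball. -/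
def component (n : ℕ) (f : E n → ℂ) : ℕ → E n → ℂ :=
  Classical.epsilon (fun F : ℕ → E n → ℂ => IsHarmonicExpansion n f F)

/-- The normalized surface measure `dσ` on the unit sphere. -/
def sphereMeasure (n : ℕ) : Measure (sphere (0 : E n) 1) :=
  ((volume : Measure (E n)).toSphere Set.univ)⁻¹ • (volume : Measure (E n)).toSphere

/-- The squared norm of (the restriction of) `g` in `L²` of the unit sphere, with values
in `[0, ∞]`. -/
def sphereNormSq (n : ℕ) (g : E n → ℂ) : ℝ≥0∞ :=
  ∫⁻ ζ : sphere (0 : E n) 1, ‖g (ζ : E n)‖ₑ ^ 2 ∂(sphereMeasure n)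

/-- The coefficient `p (n/2)_p / p!`, where `(x)_p = x (x + 1) ⋯ (x + p - 1)`. -/
def dirichletCoeff (n p : ℕ) : ℝ :=
  (p : ℝ) * (ascPochhammer ℝ p).eval ((n : ℝ) / 2) / (p ! : ℝ)

/-- The quantity `∑ₚ (p (n/2)_p / p!) ‖f_p‖²` (the square of the Dirichlet seminorm), with values
in `[0, ∞]`. -/
def dirichletNormSq (n : ℕ) (f : E n → ℂ) : ℝ≥0∞ :=
  ∑' p : ℕ, ENNReal.ofReal (dirichletCoeff n p) * sphereNormSq n (component n f p)

/-- The harmonic Dirichlet space: the functions harmonic on the unit ball whose Dirichlet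
seminorm is finite. -/
def harmonicDirichletSpace (n : ℕ) : Set (E n → ℂ) :=
  {f | HarmonicOnNhd f (ball (0 : E n) 1) ∧ dirichletNormSq n f < ∞}

/-- The measure
`dρ_s(x) = Γ(n/2 + s + 1) / (π^(n/2) Γ(s + 1)) (1 - |x|²)^s dx` on the open unit ball. -/
def ballMeasure (n : ℕ) (s : ℝ) : Measure (E n) :=
  ((volume : Measure (E n)).restrict (ball (0 : E n) 1)).withDensity fun x =>
    ENNReal.ofReal (Real.Gamma ((n : ℝ) / 2 + s + 1) /
      (Real.pi ^ ((n : ℝ) / 2) * Real.Gamma (s + 1)) * (1 - ‖x‖ ^ 2) ^ s)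

/-- The squared norm of `g` in `L²(dρ_s)`, with values in `[0, ∞]`. -/
def ballNormSq (n : ℕ) (s : ℝ) (g : E n → ℂ) : ℝ≥0∞ :=
  ∫⁻ x, ‖g x‖ₑ ^ 2 ∂(ballMeasure n s)

/-- The partial derivative `∂_k g`. -/
def partialDeriv (n : ℕ) (k : Fin n) (g : E n → ℂ) : E n → ℂ :=
  fun x => fderiv ℝ g x (EuclideanSpace.single k (1 : ℝ))

/-- Ordered pairs `(j, k)` with `j ≠ k`; there are `n (n - 1)` of them. -/
abbrev PairIndex (n : ℕ) : Type := {a : Fin n × Fin n // a.1 ≠ a.2}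

/-- The tangential vector field `X_{jk} = x_j ∂_k - x_k ∂_j`. -/
def tangential (n : ℕ) (a : PairIndex n) (g : E n → ℂ) : E n → ℂ :=
  fun x => (x a.1.1 : ℂ) * partialDeriv n a.1.2 g x - (x a.1.2 : ℂ) * partialDeriv n a.1.1 g x

/-- The composition `X_{J 0} X_{J 1} ⋯ X_{J (m - 1)} f`. -/
def iteratedTangential (n m : ℕ) (J : Fin m → PairIndex n) (f : E n → ℂ) : E n → ℂ :=
  (List.ofFn J).foldr (tangential n) f

/-- The sum over all `m`-tuples of tangential fields of
`‖X_{j₁} ⋯ X_{jₘ} f‖²` in `L²(dρ_s)` with `s = 2 m - n / 2 - 1`. -/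
def tangentialNormSq (n m : ℕ) (f : E n → ℂ) : ℝ≥0∞ :=
  ∑ J : Fin m → PairIndex n,
    ballNormSq n (2 * (m : ℝ) - (n : ℝ) / 2 - 1) (iteratedTangential n m J f)

end HarmonicDirichlet

end

noncomputable section

namespace HarmonicDirichlet

/-! Both quadratic forms are diagonal in the decomposition `f = ∑ f_p`, so the theorem reduces to
comparing two sequences of weights.

The operators `X_jk` come from rotations. They therefore preserve the harmonic polynomials of degree
`p` and are skew-adjoint on the sphere. The sum of their squares over all `j, k` equals `2(|x|²Δ -
E(E + n - 2))`, where `E` is the Euler operator, hence it acts on solid harmonics of degree `p` as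
`-2p(p + n - 2)` (`sum_rot_rot`, `avg_rot`). Two facts follow: different degrees are orthogonal, and
`m` rounds of derivatives multiply `‖f_p‖²` by `(2p(p + n - 2))^m` (`sum_nrm_rotList`). Polar
coordinates and a Beta integral show that passing from the sphere to `dρ_s` with `s = 2m - n/2 - 1`
costs a constant times `(n/2)_p / (p + 2m - 1)!` (`exists_ballWeight_eq`). Since `(p(p + n - 2))^m ≈
p^(2m)` and `(p + 2m - 1)! ≈ p^(2m-1) p!`, the product is comparable to `p (n/2)_p / p!`
(`symbol_bounds`). All sums take values in `[0, ∞]`, so the equivalence of the finiteness conditions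
and that of the seminorms come out together (`exists_tangentialNormSq_bounds`).

The analytic part justifies this. Solid harmonics decay geometrically inside the ball relative to
their sphere norm (`exists_norm_ev_le`), so expansions may be differentiated term by term, and
Parseval holds on every smaller sphere, which also gives uniqueness. For existence,
Stone–Weierstrass, the Dirichlet problem for polynomial data and the maximum principle approximate
`f` by harmonic polynomials; Cauchy-type estimates then let their homogeneous components converge.
-/

open MvPolynomial in
/-- The function on `ℝⁿ` given by a polynomial with complex coefficients. -/
def ev {n : ℕ} (P : MvPolynomial (Fin n) ℂ) (x : E n) : ℂ := eval (fun i => (x i : ℂ)) P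

/-! ### Formal polynomial calculus: Laplacian, rotational derivatives, Casimir identity -/

section Algebra

open MvPolynomial

variable {n : ℕ}

@[simp] lemma ev_add (P Q : MvPolynomial (Fin n) ℂ) (x : E n) : ev (P + Q) x = ev P x + ev Q x := by
  simp [ev]

@[simp] lemma ev_sub (P Q : MvPolynomial (Fin n) ℂ) (x : E n) : ev (P - Q) x = ev P x - ev Q x := by
  simp [ev]

@[simp] lemma ev_mul (P Q : MvPolynomial (Fin n) ℂ) (x : E n) : ev (P * Q) x = ev P x * ev Q x := by
  simp [ev]

@[simp] lemma ev_zero (x : E n) : ev (0 : MvPolynomial (Fin n) ℂ) x = 0 := by simp [ev]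

@[simp] lemma ev_X (i : Fin n) (x : E n) : ev (X i : MvPolynomial (Fin n) ℂ) x = x i := by simp [ev]

@[simp] lemma ev_C (c : ℂ) (x : E n) : ev (C c : MvPolynomial (Fin n) ℂ) x = c := by simp [ev]

@[simp] lemma ev_smul (c : ℂ) (P : MvPolynomial (Fin n) ℂ) (x : E n) :
    ev (c • P) x = c * ev P x := by simp [ev, smul_eval]

@[simp] lemma ev_pow (P : MvPolynomial (Fin n) ℂ) (k : ℕ) (x : E n) :
    ev (P ^ k) x = ev P x ^ k := by simp [ev]

@[simp] lemma ev_sum {ι : Type*} (s : Finset ι) (P : ι → MvPolynomial (Fin n) ℂ) (x : E n) :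
    ev (∑ i ∈ s, P i) x = ∑ i ∈ s, ev (P i) x := by simp [ev]

/-- The real points are a product of infinite subsets of `ℂ`, and such a set determines a
polynomial. -/
lemma ev_injective : Function.Injective (ev : MvPolynomial (Fin n) ℂ → E n → ℂ) := by
  intro P Q h
  refine funext_set (s := fun _ => Set.range ((↑) : ℝ → ℂ))
    (fun _ => Set.infinite_range_of_injective Complex.ofReal_injective) fun y hy => ?_
  choose x hx using fun i => hy i (Set.mem_univ i)
  have := congrFun h (WithLp.toLp 2 x)
  simpa [ev, hx] using this

lemma ev_real_smul {P : MvPolynomial (Fin n) ℂ} {p : ℕ} (hP : P.IsHomogeneous p) (r : ℝ) (x : E n) :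
    ev P (r • x) = (r : ℂ) ^ p * ev P x := by
  simp only [ev, PiLp.smul_apply, smul_eq_mul, Complex.ofReal_mul, eval_eq', Finset.mul_sum]
  refine Finset.sum_congr rfl fun d hd => ?_
  have hdeg : ∑ i, d i = p := by
    rw [hP.degree_eq_sum_deg_support hd]
    exact (Finset.sum_subset (Finset.subset_univ _) fun i _ hi => by simpa using hi).symm
  simp only [mul_pow, Finset.prod_mul_distrib, Finset.prod_pow_eq_pow_sum, hdeg]
  ring

lemma continuous_ev (P : MvPolynomial (Fin n) ℂ) : Continuous (ev P) := by
  unfold ev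
  exact (MvPolynomial.continuous_eval P).comp (by fun_prop)

/-- The polynomial `|x|²`. -/
def sqNorm (n : ℕ) : MvPolynomial (Fin n) ℂ := ∑ i, X i ^ 2

lemma ev_sqNorm (x : E n) : ev (sqNorm n) x = ((‖x‖ ^ 2 : ℝ) : ℂ) := by
  simp [sqNorm, EuclideanSpace.norm_sq_eq]

/-- The formal Laplacian of a polynomial. -/
def lap (P : MvPolynomial (Fin n) ℂ) : MvPolynomial (Fin n) ℂ := ∑ k, pderiv k (pderiv k P)

/-- The formal rotational derivative `x_j ∂_k - x_k ∂_j`. -/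
def rot (j k : Fin n) (P : MvPolynomial (Fin n) ℂ) : MvPolynomial (Fin n) ℂ :=
  X j * pderiv k P - X k * pderiv j P

lemma lap_add (P Q : MvPolynomial (Fin n) ℂ) : lap (P + Q) = lap P + lap Q := by
  simp [lap, Finset.sum_add_distrib]

lemma lap_smul (c : ℂ) (P : MvPolynomial (Fin n) ℂ) : lap (c • P) = c • lap P := by
  simp [lap, Finset.smul_sum]

lemma lap_sub (P Q : MvPolynomial (Fin n) ℂ) : lap (P - Q) = lap P - lap Q := by
  simp [lap, Finset.sum_sub_distrib]

lemma pderiv_comm (i j : Fin n) (P : MvPolynomial (Fin n) ℂ) :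
    pderiv i (pderiv j P) = pderiv j (pderiv i P) := by
  have h : ⁅(pderiv i : Derivation ℂ (MvPolynomial (Fin n) ℂ) (MvPolynomial (Fin n) ℂ)),
      (pderiv j : Derivation ℂ (MvPolynomial (Fin n) ℂ) (MvPolynomial (Fin n) ℂ))⁆ = 0 := by
    ext1 k
    rw [Derivation.commutator_apply]
    classical
    simp [pderiv_X, Pi.single_apply, apply_ite]
  have := congrArg (fun D => D P) h
  simpa [Derivation.commutator_apply, sub_eq_zero] using this

lemma lap_pderiv (i : Fin n) (P : MvPolynomial (Fin n) ℂ) :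
    lap (pderiv i P) = pderiv i (lap P) := by
  simp only [lap, map_sum]
  refine Finset.sum_congr rfl fun k _ => ?_
  rw [pderiv_comm k i, pderiv_comm k i]

lemma lap_X_mul (i : Fin n) (P : MvPolynomial (Fin n) ℂ) :
    lap (X i * P) = 2 * pderiv i P + X i * lap P := by
  classical
  simp only [lap, Derivation.leibniz, smul_eq_mul, pderiv_X, map_add, Finset.sum_add_distrib,
    Finset.mul_sum]
  simp [Pi.single_apply, apply_ite]
  ring

lemma lap_rot (j k : Fin n) (P : MvPolynomial (Fin n) ℂ) : lap (rot j k P) = rot j k (lap P) := by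
  simp only [rot, lap_sub, lap_X_mul, lap_pderiv, pderiv_comm j k]
  ring

lemma rot_mul (j k : Fin n) (P Q : MvPolynomial (Fin n) ℂ) :
    rot j k (P * Q) = rot j k P * Q + P * rot j k Q := by
  simp only [rot, Derivation.leibniz, smul_eq_mul]
  ring

lemma isHomogeneous_pderiv_succ {P : MvPolynomial (Fin n) ℂ} {p : ℕ} (hP : P.IsHomogeneous (p + 1))
    (k : Fin n) : (pderiv k P).IsHomogeneous p := by
  simpa using hP.pderiv (i := k)

lemma pderiv_eq_zero_of_isHomogeneous_zero {P : MvPolynomial (Fin n) ℂ} (hP : P.IsHomogeneous 0)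
    (k : Fin n) : pderiv k P = 0 := by
  rw [totalDegree_eq_zero_iff_eq_C.1 ((totalDegree_zero_iff_isHomogeneous _).2 hP)]
  simp

lemma isHomogeneous_rot {P : MvPolynomial (Fin n) ℂ} {p : ℕ} (hP : P.IsHomogeneous p)
    (j k : Fin n) : (rot j k P).IsHomogeneous p := by
  rcases p with _ | p
  · simp [rot, pderiv_eq_zero_of_isHomogeneous_zero hP, isHomogeneous_zero]
  · have h : ∀ i l : Fin n, (X i * pderiv l P).IsHomogeneous (p + 1) := fun i l => by
      simpa [add_comm] using (isHomogeneous_X ℂ i).mul (isHomogeneous_pderiv_succ hP l)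
    exact (h j k).sub (h k j)

/-- Casimir identity: on homogeneous polynomials the Euler operator is multiplication by `p`, so the
sum of squares reduces to `|x|²Δ` and a scalar. The pairs with `j = k` contribute zero. -/
lemma sum_rot_rot {P : MvPolynomial (Fin n) ℂ} {p : ℕ} (hP : P.IsHomogeneous p) :
    ∑ j, ∑ k, rot j k (rot j k P) =
      2 * (sqNorm n * lap P) - C (2 * (p * (p + n - 2)) : ℂ) * P := by
  classical
  have e1 : ∑ i, X i * pderiv i P = (p : MvPolynomial (Fin n) ℂ) * P := by
    simpa [nsmul_eq_mul] using hP.sum_X_mul_pderiv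
  -- Second-order Euler identity, obtained by applying the Euler operator twice and removing the
  -- first-order part.
  have e2 : ∑ j, ∑ k, X j * (X k * pderiv k (pderiv j P))
      = (p : MvPolynomial (Fin n) ℂ) * p * P - p * P := by
    have h : ∑ k, X k * pderiv k (∑ j, X j * pderiv j P) =
        (p : MvPolynomial (Fin n) ℂ) * (p * P) := by
      rw [e1, ← e1, Finset.mul_sum]
      refine Finset.sum_congr rfl fun k _ => ?_
      rw [e1, Derivation.leibniz]
      simp
      ring
    simp only [map_sum, Derivation.leibniz, smul_eq_mul, pderiv_X, Finset.mul_sum, mul_add,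
      Finset.sum_add_distrib] at h
    simp only [Pi.single_apply, mul_ite, mul_one, mul_zero, Finset.sum_ite_eq',
      Finset.mem_univ, if_true, e1] at h
    rw [Finset.sum_comm] at h
    have h' : ∑ j, ∑ k, X j * (X k * pderiv k (pderiv j P)) = ∑ j, ∑ k, X k * (X j * pderiv k (pderiv j P)) := by
      refine Finset.sum_congr rfl fun j _ => Finset.sum_congr rfl fun k _ => by ring
    rw [h']
    linear_combination h
  -- The last summand corrects the diagonal, where `∂_k x_j` does not vanish and the generic
  -- expansion would not give zero.
  have key : ∀ j k : Fin n, rot j k (rot j k P) =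
      X j ^ 2 * pderiv k (pderiv k P) + X k ^ 2 * pderiv j (pderiv j P)
      - X j * (X k * pderiv k (pderiv j P)) - X k * (X j * pderiv j (pderiv k P))
      - X j * pderiv j P - X k * pderiv k P
      + (if j = k then X j * pderiv k P + X k * pderiv j P else 0) := by
    intro j k
    simp only [rot, map_sub, Derivation.leibniz, smul_eq_mul, pderiv_X, Pi.single_apply]
    by_cases h : j = k
    · subst h; simp; ring
    · simp [h, Ne.symm h]
      ring
  simp only [key, Finset.sum_add_distrib, Finset.sum_sub_distrib]
  have s1 : ∑ j : Fin n, ∑ k : Fin n, X j ^ 2 * pderiv k (pderiv k P) = sqNorm n * lap P := by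
    simp [sqNorm, lap, Finset.sum_mul_sum]
  have s2 : ∑ j : Fin n, ∑ k : Fin n, X k ^ 2 * pderiv j (pderiv j P) = sqNorm n * lap P := by
    rw [Finset.sum_comm, s1]
  have s3 : ∑ j : Fin n, ∑ k : Fin n, X k * (X j * pderiv j (pderiv k P)) = 
      (p : MvPolynomial (Fin n) ℂ) * p * P - p * P := by
    rw [Finset.sum_comm, e2]
  rw [s1, s2, s3, e2]
  simp only [Finset.sum_ite_eq, Finset.mem_univ, if_true, Finset.sum_const, Finset.card_univ,
    Fintype.card_fin, nsmul_eq_mul, Finset.sum_add_distrib, e1, ← Finset.mul_sum]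
  simp only [map_mul, map_sub, map_add, map_ofNat, map_natCast]
  ring

/-- Conjugation of the coefficients. -/
def cj (P : MvPolynomial (Fin n) ℂ) : MvPolynomial (Fin n) ℂ := map (starRingEnd ℂ) P

lemma ev_cj (P : MvPolynomial (Fin n) ℂ) (x : E n) : ev (cj P) x = starRingEnd ℂ (ev P x) := by
  simp only [ev, cj, eval_map]
  induction P using MvPolynomial.induction_on with
  | C a => simp
  | add p q hp hq => simp_all
  | mul_X p i hp => simp_all

lemma cj_pderiv (k : Fin n) (P : MvPolynomial (Fin n) ℂ) : cj (pderiv k P) = pderiv k (cj P) :=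
  pderiv_map.symm

lemma cj_rot (j k : Fin n) (P : MvPolynomial (Fin n) ℂ) : cj (rot j k P) = rot j k (cj P) := by
  simp only [rot, cj, pderiv_map, map_sub, map_mul, map_X]

lemma lap_cj (P : MvPolynomial (Fin n) ℂ) : lap (cj P) = cj (lap P) := by
  simp only [lap, cj, pderiv_map, map_sum]

lemma isHomogeneous_cj {P : MvPolynomial (Fin n) ℂ} {p : ℕ} (hP : P.IsHomogeneous p) :
    (cj P).IsHomogeneous p := hP.map _

lemma lap_mul (P Q : MvPolynomial (Fin n) ℂ) :
    lap (P * Q) = lap P * Q + 2 * (∑ k, pderiv k P * pderiv k Q) + P * lap Q := by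
  simp only [lap, Derivation.leibniz, smul_eq_mul, map_add, Finset.sum_mul, Finset.mul_sum,
    ← Finset.sum_add_distrib]
  refine Finset.sum_congr rfl fun k _ => by ring

end Algebra

/-! ### Formal derivatives agree with analytic ones; solid harmonics -/

section Calculus

open MvPolynomial

variable {n : ℕ}

lemma hasFDerivAt_ev (P : MvPolynomial (Fin n) ℂ) (x : E n) :
    HasFDerivAt (ev P)
      (∑ k, (EuclideanSpace.proj k : E n →L[ℝ] ℝ).smulRight (ev (pderiv k P) x)) x := by
  induction P using MvPolynomial.induction_on with
  | C a =>
    have : ev (C a : MvPolynomial (Fin n) ℂ) = fun _ => a := by ext; simp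
    rw [this]
    convert! hasFDerivAt_const a x
    ext v
    simp
  | add p q hp hq =>
    have : ev (p + q) = fun x => ev p x + ev q x := by ext; simp
    rw [this]
    convert! hp.add hq using 1
    ext v
    simp [Finset.sum_add_distrib]
  | mul_X p i hp =>
    have : ev (p * X i) = fun x => ev p x * ((x i : ℝ) : ℂ) := by ext; simp
    rw [this]
    have hX : HasFDerivAt (fun y : E n => ((y i : ℝ) : ℂ))
        (Complex.ofRealCLM.comp (EuclideanSpace.proj i : E n →L[ℝ] ℝ)) x :=
      (Complex.ofRealCLM.comp (EuclideanSpace.proj i : E n →L[ℝ] ℝ)).hasFDerivAt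
    convert! hp.mul hX using 1
    classical
    ext v
    simp [Derivation.leibniz, pderiv_X, Pi.single_apply, apply_ite ev, ite_apply,
      Finset.sum_add_distrib, Finset.mul_sum, smul_eq_mul]
    simp only [mul_left_comm]
    simp [mul_comm]

lemma partialDeriv_ev (k : Fin n) (P : MvPolynomial (Fin n) ℂ) :
    partialDeriv n k (ev P) = ev (pderiv k P) := by
  ext x
  rw [partialDeriv, (hasFDerivAt_ev P x).fderiv]
  simp

lemma tangential_ev (a : PairIndex n) (P : MvPolynomial (Fin n) ℂ) :
    tangential n a (ev P) = ev (rot a.1.1 a.1.2 P) := by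
  ext x
  simp [tangential, partialDeriv_ev, rot]

lemma contDiff_ev {m : WithTop ℕ∞} (P : MvPolynomial (Fin n) ℂ) : ContDiff ℝ m (ev P) := by
  induction P using MvPolynomial.induction_on with
  | C a =>
    have : ev (C a : MvPolynomial (Fin n) ℂ) = fun _ => a := by ext; simp
    rw [this]
    exact contDiff_const
  | add p q hp hq =>
    have : ev (p + q) = fun x => ev p x + ev q x := by ext; simp
    rw [this]
    exact hp.add hq
  | mul_X p i hp =>
    have : ev (p * X i) = fun x => ev p x * ((x i : ℝ) : ℂ) := by ext; simp
    rw [this]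
    exact hp.mul (Complex.ofRealCLM.comp (EuclideanSpace.proj i : E n →L[ℝ] ℝ)).contDiff

lemma laplacian_eq_sum_partialDeriv {f : E n → ℂ} {x : E n} (hf : ContDiffAt ℝ 2 f x) :
    Laplacian.laplacian f x = ∑ k, partialDeriv n k (partialDeriv n k f) x := by
  rw [laplacian_eq_iteratedFDeriv_orthonormalBasis f (EuclideanSpace.basisFun (Fin n) ℝ)]
  refine Finset.sum_congr rfl fun k _ => ?_
  rw [iteratedFDeriv_two_apply]
  simp only [Fin.isValue, EuclideanSpace.basisFun_apply, Matrix.cons_val_zero, Matrix.cons_val_one]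
  have hd : DifferentiableAt ℝ (fderiv ℝ f) x :=
    (hf.fderiv_right (m := 1) (by norm_num)).differentiableAt (by norm_num)
  change _ = fderiv ℝ (fun y => fderiv ℝ f y (EuclideanSpace.single k 1)) x
    (EuclideanSpace.single k 1)
  rw [fderiv_clm_apply hd (differentiableAt_const _)]
  simp

lemma laplacian_ev (P : MvPolynomial (Fin n) ℂ) : Laplacian.laplacian (ev P) = ev (lap P) := by
  ext x
  rw [laplacian_eq_sum_partialDeriv (contDiff_ev P).contDiffAt]
  simp [partialDeriv_ev, lap]

lemma harmonicOnNhd_ev_iff (P : MvPolynomial (Fin n) ℂ) :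
    HarmonicOnNhd (ev P) Set.univ ↔ lap P = 0 := by
  constructor
  · intro h
    refine ev_injective (funext fun x => ?_)
    rw [← laplacian_ev, (h x trivial).2.self_of_nhds]
    simp
  · intro h x _
    refine ⟨(contDiff_ev P).contDiffAt, Eventually.of_forall fun y => ?_⟩
    rw [laplacian_ev, h]
    simp

/-- A polynomial is solid harmonic of degree `p` if it is homogeneous of degree `p` and harmonic. -/
structure IsSolid (p : ℕ) (P : MvPolynomial (Fin n) ℂ) : Prop where
  homogeneous : P.IsHomogeneous p
  lap_eq_zero : lap P = 0

lemma isSolidHarmonic_iff {p : ℕ} {g : E n → ℂ} :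
    IsSolidHarmonic n p g ↔ ∃ P : MvPolynomial (Fin n) ℂ, IsSolid p P ∧ g = ev P := by
  constructor
  · rintro ⟨⟨P, hP, hg⟩, hh⟩
    have hg' : g = ev P := funext hg
    subst hg'
    exact ⟨P, ⟨hP, (harmonicOnNhd_ev_iff P).1 hh⟩, rfl⟩
  · rintro ⟨P, hP, rfl⟩
    exact ⟨⟨P, hP.1, fun _ => rfl⟩, (harmonicOnNhd_ev_iff P).2 hP.2⟩

lemma IsSolid.isSolid_rot {p : ℕ} {P : MvPolynomial (Fin n) ℂ} (hP : IsSolid p P) (j k : Fin n) :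
    IsSolid p (rot j k P) :=
  ⟨isHomogeneous_rot hP.1 j k, by rw [lap_rot, hP.2]; simp [rot]⟩

lemma IsSolid.isSolid_pderiv {p : ℕ} {P : MvPolynomial (Fin n) ℂ} (hP : IsSolid p P) (k : Fin n) :
    IsSolid (p - 1) (pderiv k P) :=
  ⟨hP.1.pderiv, by rw [lap_pderiv, hP.2]; simp⟩

lemma IsSolid.isSolid_cj {p : ℕ} {P : MvPolynomial (Fin n) ℂ} (hP : IsSolid p P) : IsSolid p (cj P) :=
  ⟨isHomogeneous_cj hP.1, by rw [lap_cj, hP.2]; simp [cj]⟩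

end Calculus

/-! ### Plane rotations and rotation invariance of the surface measure -/

section Rotation

variable {n : ℕ}

/-- Rotation by the angle `t` in the plane of the `j`-th and `k`-th coordinates. -/
def planeRot (j k : Fin n) (t : ℝ) : E n →ₗ[ℝ] E n where
  toFun x := x + (Real.cos t - 1) • (x j • EuclideanSpace.single j (1 : ℝ) +
    x k • EuclideanSpace.single k (1 : ℝ)) +
    Real.sin t • (x j • EuclideanSpace.single k (1 : ℝ) - x k • EuclideanSpace.single j (1 : ℝ))
  map_add' x y := by
    simp only [PiLp.add_apply, add_smul, smul_add, smul_sub, smul_smul]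
    module
  map_smul' c x := by
    simp only [PiLp.smul_apply, smul_eq_mul, RingHom.id_apply]
    module

lemma planeRot_apply (j k : Fin n) (t : ℝ) (x : E n) : planeRot j k t x =
    x + (Real.cos t - 1) • (x j • EuclideanSpace.single j (1 : ℝ) +
    x k • EuclideanSpace.single k (1 : ℝ)) +
    Real.sin t • (x j • EuclideanSpace.single k (1 : ℝ) - x k • EuclideanSpace.single j (1 : ℝ)) :=
  rfl

lemma planeRot_apply_left {j k : Fin n} (h : j ≠ k) (t : ℝ) (x : E n) :
    planeRot j k t x j = Real.cos t * x j - Real.sin t * x k := by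
  simp [planeRot_apply, h]
  ring

lemma planeRot_apply_right {j k : Fin n} (h : j ≠ k) (t : ℝ) (x : E n) :
    planeRot j k t x k = Real.sin t * x j + Real.cos t * x k := by
  simp [planeRot_apply, h.symm]
  ring

lemma norm_planeRot {j k : Fin n} (h : j ≠ k) (t : ℝ) (x : E n) : ‖planeRot j k t x‖ = ‖x‖ := by
  rw [← sq_eq_sq₀ (norm_nonneg _) (norm_nonneg _), EuclideanSpace.real_norm_sq_eq,
    EuclideanSpace.real_norm_sq_eq, ← sub_eq_zero, ← Finset.sum_sub_distrib,
    Fintype.sum_eq_add j k h, planeRot_apply_left h, planeRot_apply_right h]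
  · linear_combination (x j ^ 2 + x k ^ 2) * Real.sin_sq_add_cos_sq t
  · rintro i ⟨hj, hk⟩
    simp [planeRot_apply, hj, hk]

/-- Rotation in a coordinate plane as an isometry. -/
def planeRotEquiv {j k : Fin n} (h : j ≠ k) (t : ℝ) : E n ≃ₗᵢ[ℝ] E n :=
  (⟨planeRot j k t, norm_planeRot h t⟩ : E n →ₗᵢ[ℝ] E n).toLinearIsometryEquiv rfl

@[simp] lemma planeRotEquiv_apply {j k : Fin n} (h : j ≠ k) (t : ℝ) (x : E n) :
    planeRotEquiv h t x = planeRot j k t x := rfl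

lemma hasDerivAt_planeRot (j k : Fin n) (t : ℝ) (x : E n) :
    HasDerivAt (fun s => planeRot j k s x) ((-Real.sin t) • (x j • EuclideanSpace.single j (1 : ℝ) +
    x k • EuclideanSpace.single k (1 : ℝ)) +
    Real.cos t • (x j • EuclideanSpace.single k (1 : ℝ) -
      x k • EuclideanSpace.single j (1 : ℝ))) t := by
  simp only [planeRot_apply]
  exact ((((Real.hasDerivAt_cos t).sub_const 1).smul_const _).const_add x).add
    ((Real.hasDerivAt_sin t).smul_const _)

/-- The field `X_jk` generates the flow of rotations in the `(j, k)` plane. -/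
lemma hasDerivAt_ev_planeRot {j k : Fin n} (h : j ≠ k) (P : MvPolynomial (Fin n) ℂ) (t : ℝ)
    (x : E n) : HasDerivAt (fun s => ev P (planeRot j k s x)) (ev (rot j k P) (planeRot j k t x)) t := by
  convert! (hasFDerivAt_ev P (planeRot j k t x)).comp_hasDerivAt t (hasDerivAt_planeRot j k t x) using 1
  rw [sum_apply, Fintype.sum_eq_add j k h]
  · simp [h, h.symm, rot, planeRot_apply_left h, planeRot_apply_right h]
    ring
  · rintro i ⟨hj, hk⟩
    simp [hj, hk]

lemma continuous_planeRot (j k : Fin n) :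
    Continuous fun q : ℝ × E n => planeRot j k q.1 q.2 := by
  simp only [planeRot_apply]
  fun_prop

lemma continuous_ev_planeRot (j k : Fin n) (P : MvPolynomial (Fin n) ℂ) :
    Continuous fun q : ℝ × E n => ev P (planeRot j k q.1 q.2) :=
  (continuous_ev P).comp (continuous_planeRot j k)

lemma continuous_ev_planeRot_sphere (j k : Fin n) (P : MvPolynomial (Fin n) ℂ) :
    Continuous fun q : ℝ × sphere (0 : E n) 1 => ev P (planeRot j k q.1 q.2) := by
  have h : Continuous fun q : ℝ × sphere (0 : E n) 1 => (q.1, (q.2 : E n)) := by fun_prop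
  simpa only [Function.comp_def] using (continuous_ev_planeRot j k P).comp h

/-- The action of a linear isometry on the unit sphere. -/
def sphereMap (e : E n ≃ₗᵢ[ℝ] E n) (ζ : sphere (0 : E n) 1) : sphere (0 : E n) 1 :=
  ⟨e ζ, by simp⟩

lemma continuous_sphereMap (e : E n ≃ₗᵢ[ℝ] E n) : Continuous (sphereMap e) := by
  unfold sphereMap
  fun_prop

-- The surface measure of a set is defined through the volume of the cone over it, and an isometry
-- maps cones to cones preserving volume.
open scoped Pointwise in
lemma measurePreserving_sphereMap (e : E n ≃ₗᵢ[ℝ] E n) :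
    MeasurePreserving (sphereMap e) (sphereMeasure n) (sphereMeasure n) := by
  refine ⟨(continuous_sphereMap e).measurable, Measure.ext fun s hs => ?_⟩
  have hm : MeasurableSet (sphereMap e ⁻¹' s) := (continuous_sphereMap e).measurable hs
  rw [Measure.map_apply (continuous_sphereMap e).measurable hs, sphereMeasure, Measure.smul_apply,
    Measure.smul_apply, Measure.toSphere_apply' _ hs, Measure.toSphere_apply' _ hm]
  congr 2
  have : Set.Ioo (0 : ℝ) 1 • ((↑) '' (sphereMap e ⁻¹' s) : Set (E n)) =
      e ⁻¹' (Set.Ioo (0 : ℝ) 1 • ((↑) '' s : Set (E n))) := by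
    ext x
    simp only [Set.mem_smul, Set.mem_image, Set.mem_preimage]
    constructor
    · rintro ⟨r, hr, _, ⟨ζ, hζ, rfl⟩, rfl⟩
      exact ⟨r, hr, _, ⟨_, hζ, rfl⟩, by simp [sphereMap]⟩
    · rintro ⟨r, hr, _, ⟨ζ, hζ, rfl⟩, hx⟩
      refine ⟨r, hr, _, ⟨sphereMap e.symm ζ, ?_, rfl⟩, ?_⟩
      · simpa [sphereMap] using hζ
      · simp only [sphereMap, ← map_smul, hx]
        simp
  rw [this]
  exact e.measurePreserving.measure_preimage_equiv (f := e.toMeasurableEquiv) _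

end Rotation

/-! ### Means over the unit sphere -/

section Sphere

variable {n : ℕ}

lemma continuous_ev_sphere (P : MvPolynomial (Fin n) ℂ) :
    Continuous fun ζ : sphere (0 : E n) 1 => ev P ζ :=
  (continuous_ev P).comp continuous_subtype_val

/-- The mean of a polynomial over the unit sphere. -/
def avg (P : MvPolynomial (Fin n) ℂ) : ℂ := ∫ ζ : sphere (0 : E n) 1, ev P ζ ∂(sphereMeasure n)

lemma avg_smul (c : ℂ) (P : MvPolynomial (Fin n) ℂ) : avg (c • P) = c * avg P := by
  simp only [avg, ev_smul]
  exact integral_const_mul _ _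

lemma avg_comp_isometry (P : MvPolynomial (Fin n) ℂ) (e : E n ≃ₗᵢ[ℝ] E n) :
    ∫ ζ : sphere (0 : E n) 1, ev P (e ζ) ∂(sphereMeasure n) = avg P := by
  have := (measurePreserving_sphereMap e).map_eq
  rw [avg]
  conv_rhs => rw [← this]
  rw [integral_map (continuous_sphereMap _).aemeasurable
      (continuous_ev_sphere _).aestronglyMeasurable]
  rfl

variable [hn : Fact (2 ≤ n)]

instance : Nontrivial (E n) := by
  have : Nontrivial (Fin n) := Fin.nontrivial_iff_two_le.2 hn.out
  infer_instance

instance : IsProbabilityMeasure (sphereMeasure n) :=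
  ⟨by
    rw [sphereMeasure, Measure.smul_apply, smul_eq_mul]
    exact ENNReal.inv_mul_cancel
      (Measure.measure_univ_ne_zero.2 (Measure.toSphere_ne_zero _)) (measure_ne_top _ _)⟩

lemma integrable_sphere {F : Type*} [NormedAddCommGroup F] {f : sphere (0 : E n) 1 → F}
    (hf : Continuous f) : Integrable f (sphereMeasure n) :=
  hf.integrable_of_hasCompactSupport (HasCompactSupport.of_compactSpace f)

lemma avg_add (P Q : MvPolynomial (Fin n) ℂ) : avg (P + Q) = avg P + avg Q := by
  simp only [avg, ev_add]
  exact integral_add (integrable_sphere (continuous_ev_sphere P))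
    (integrable_sphere (continuous_ev_sphere Q))

/-- The mean over the sphere as a linear functional. -/
def avgₗ (n : ℕ) [Fact (2 ≤ n)] : MvPolynomial (Fin n) ℂ →ₗ[ℂ] ℂ where
  toFun := avg
  map_add' := avg_add
  map_smul' := avg_smul

lemma avg_sub (P Q : MvPolynomial (Fin n) ℂ) : avg (P - Q) = avg P - avg Q :=
  map_sub (avgₗ n) P Q

lemma avg_sum {ι : Type*} (s : Finset ι) (P : ι → MvPolynomial (Fin n) ℂ) :
    avg (∑ i ∈ s, P i) = ∑ i ∈ s, avg (P i) :=
  map_sum (avgₗ n) P s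


lemma integrable_prod_sphere {f : ℝ × sphere (0 : E n) 1 → ℂ} (hf : Continuous f) (a b : ℝ) :
    Integrable f ((volume.restrict (Set.uIoc a b)).prod (sphereMeasure n)) := by
  have h : IntegrableOn f (Set.uIcc a b ×ˢ Set.univ) (volume.prod (sphereMeasure n)) :=
    hf.continuousOn.integrableOn_compact (isCompact_uIcc.prod isCompact_univ)
  have h2 := h.mono_set (Set.prod_mono_left (t := Set.univ) Set.uIoc_subset_uIcc)
  rwa [IntegrableOn, ← Measure.prod_restrict, Measure.restrict_univ] at h2

/-- Integrate `X_jk P` along the rotation flow over a full period and over the sphere. By invariance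
the result is `2π` times the mean; by the fundamental theorem of calculus on each periodic orbit it
is zero. -/
lemma avg_rot (j k : Fin n) (P : MvPolynomial (Fin n) ℂ) : avg (rot j k P) = 0 := by
  by_cases h : j = k
  · subst h
    simp [avg, rot]
  have hinv : ∀ t : ℝ, ∫ ζ : sphere (0 : E n) 1, ev (rot j k P) (planeRot j k t ζ)
      ∂(sphereMeasure n) = avg (rot j k P) := fun t => avg_comp_isometry _ (planeRotEquiv h t)
  have hc := continuous_ev_planeRot_sphere j k (rot j k P)
  have hswap := intervalIntegral_integral_swap (a := 0) (b := 2 * Real.pi)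
    (f := fun t (ζ : sphere (0 : E n) 1) => ev (rot j k P) (planeRot j k t ζ))
    (integrable_prod_sphere hc _ _)
  have hftc : ∀ ζ : sphere (0 : E n) 1, ∫ t in (0 : ℝ)..(2 * Real.pi),
      ev (rot j k P) (planeRot j k t ζ) = 0 := by
    intro ζ
    rw [intervalIntegral.integral_eq_sub_of_hasDerivAt
      (fun t _ => hasDerivAt_ev_planeRot h P t (ζ : E n))]
    · simp [planeRot_apply]
    · exact (hc.comp (Continuous.prodMk_left ζ)).intervalIntegrable _ _
  simp only [hinv, hftc, intervalIntegral.integral_const, integral_zero, sub_zero] at hswap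
  simpa [Real.pi_ne_zero] using hswap

end Sphere

/-! ### Orthogonality and derivative identities on the sphere -/

section SphereNorm

open MvPolynomial

variable {n : ℕ}

/-- The squared norm of a polynomial in `L²` of the unit sphere. -/
def nrm (P : MvPolynomial (Fin n) ℂ) : ℝ :=
  ∫ ζ : sphere (0 : E n) 1, ‖ev P ζ‖ ^ 2 ∂(sphereMeasure n)

lemma nrm_nonneg (P : MvPolynomial (Fin n) ℂ) : 0 ≤ nrm P :=
  integral_nonneg fun _ => by positivity

lemma avg_cj_mul_self (P : MvPolynomial (Fin n) ℂ) : avg (cj P * P) = nrm P := by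
  rw [avg, nrm]
  refine Eq.trans ?_ integral_ofReal
  refine integral_congr_ae (Eventually.of_forall fun ζ => ?_)
  simp [ev_cj, Complex.conj_mul']

lemma avg_sqNorm_mul (P : MvPolynomial (Fin n) ℂ) : avg (sqNorm n * P) = avg P := by
  simp [avg, ev_sqNorm]

lemma IsSolid.sum_rot_rot_eq {p : ℕ} {P : MvPolynomial (Fin n) ℂ} (hP : IsSolid p P) :
    ∑ j, ∑ k, rot j k (rot j k P) = (-(2 * (p * (p + n - 2))) : ℂ) • P := by
  rw [sum_rot_rot hP.1, hP.2, smul_eq_C_mul]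
  simp

variable [hn : Fact (2 ≤ n)]

lemma sphereNormSq_ev (P : MvPolynomial (Fin n) ℂ) :
    sphereNormSq n (ev P) = ENNReal.ofReal (nrm P) := by
  have hc := continuous_ev_sphere P
  have hc2 : Continuous fun ζ : sphere (0 : E n) 1 => ‖ev P ζ‖ ^ 2 := by fun_prop
  rw [sphereNormSq, nrm, ofReal_integral_eq_lintegral_ofReal
    (integrable_sphere hc2) (Eventually.of_forall fun _ => by positivity)]
  refine lintegral_congr fun ζ => ?_
  rw [ENNReal.ofReal_pow (norm_nonneg _), ofReal_norm]

lemma nrm_eq_zero_iff {P : MvPolynomial (Fin n) ℂ} :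
    nrm P = 0 ↔ ∀ ζ : sphere (0 : E n) 1, ev P ζ = 0 := by
  have hc := continuous_ev_sphere P
  have hc2 : Continuous fun ζ : sphere (0 : E n) 1 => ‖ev P ζ‖ ^ 2 := by fun_prop
  constructor
  · intro h
    have : (sphereMeasure n).IsOpenPosMeasure := by
      unfold sphereMeasure
      exact Measure.isOpenPosMeasure_smul _ (ENNReal.inv_ne_zero.2 (measure_ne_top _ _))
    rw [nrm, integral_eq_zero_iff_of_nonneg (fun _ => sq_nonneg _)
      (integrable_sphere hc2), Continuous.ae_eq_iff_eq _ hc2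
      continuous_zero] at h
    intro ζ
    simpa using congrFun h ζ
  · intro h
    simp [nrm, h]

lemma IsSolid.eq_zero_of_nrm_eq_zero {p : ℕ} {P : MvPolynomial (Fin n) ℂ} (hP : IsSolid p P)
    (h : nrm P = 0) : P = 0 := by
  have h0 := nrm_eq_zero_iff.1 h
  refine ev_injective (funext fun x => ?_)
  have key : ∀ x : E n, x ≠ 0 → ev P x = 0 := by
    intro x hx
    have h1 : x = ‖x‖ • (‖x‖⁻¹ • x) := by
      rw [smul_smul, mul_inv_cancel₀ (norm_ne_zero_iff.2 hx), one_smul]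
    have h2 := h0 ⟨‖x‖⁻¹ • x, by
      simp [norm_smul, inv_mul_cancel₀ (norm_ne_zero_iff.2 hx)]⟩
    rw [h1, ev_real_smul hP.1, h2, mul_zero]
  have hd : Dense ({0}ᶜ : Set (E n)) := dense_compl_singleton 0
  have := Continuous.ext_on hd (continuous_ev P) (continuous_const (y := (0 : ℂ)))
    (fun x hx => key x hx)
  simpa using congrFun this x

/-- Integration by parts: `X_jk` is a real derivation whose image has mean zero, so it is
skew-adjoint. -/
lemma avg_cj_rot_mul (j k : Fin n) (P Q : MvPolynomial (Fin n) ℂ) :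
    avg (cj (rot j k P) * Q) = -avg (cj P * rot j k Q) := by
  have h := avg_rot j k (cj P * Q)
  rw [rot_mul, avg_add, ← cj_rot] at h
  exact eq_neg_of_add_eq_zero_left h

/-- Move one derivative across and use that `Q` is an eigenvector of the Casimir operator; nothing
is needed of `P`. -/
lemma sum_avg_cj_rot_mul_rot {q : ℕ} (P : MvPolynomial (Fin n) ℂ) {Q : MvPolynomial (Fin n) ℂ}
    (hQ : IsSolid q Q) : ∑ j, ∑ k, avg (cj (rot j k P) * rot j k Q) =
      2 * (q * (q + n - 2)) * avg (cj P * Q) := by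
  have h : ∑ j, ∑ k, avg (cj P * rot j k (rot j k Q)) =
      avg (cj P * ∑ j, ∑ k, rot j k (rot j k Q)) := by
    simp only [Finset.mul_sum, avg_sum]
  rw [hQ.sum_rot_rot_eq, mul_smul_comm, avg_smul] at h
  simp only [avg_cj_rot_mul, Finset.sum_neg_distrib, h]
  ring

lemma IsSolid.sum_nrm_rot {p : ℕ} {P : MvPolynomial (Fin n) ℂ} (hP : IsSolid p P) :
    ∑ j, ∑ k, nrm (rot j k P) = 2 * (p * (p + n - 2)) * nrm P := by
  have h := sum_avg_cj_rot_mul_rot P hP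
  simp only [avg_cj_mul_self] at h
  exact_mod_cast h

lemma IsSolid.sum_pairIndex_nrm_rot {p : ℕ} {P : MvPolynomial (Fin n) ℂ} (hP : IsSolid p P) :
    ∑ a : PairIndex n, nrm (rot a.1.1 a.1.2 P) =
      2 * (p * (p + n - 2)) * nrm P := by
  rw [← hP.sum_nrm_rot, ← Fintype.sum_prod_type', ← Finset.sum_subtype
    (Finset.univ.filter fun a : Fin n × Fin n => a.1 ≠ a.2) (by simp)
    (fun a : Fin n × Fin n => nrm (rot a.1 a.2 P)), Finset.sum_filter_of_ne]
  rintro ⟨j, k⟩ - h hjk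
  obtain rfl : j = k := hjk
  exact h (by simp [rot, nrm])

/-- Eigenvectors of a symmetric operator with different eigenvalues are orthogonal. The eigenvalues
differ because their difference is proportional to `(q - p)(q + p + n - 2)`, whose second factor
vanishes only for `p = q = 0`. -/
lemma IsSolid.avg_cj_mul_eq_zero {p q : ℕ} {P Q : MvPolynomial (Fin n) ℂ} (hP : IsSolid p P)
    (hQ : IsSolid q Q) (hpq : p ≠ q) : avg (cj P * Q) = 0 := by
  have h1 := sum_avg_cj_rot_mul_rot P hQ
  have h2 := sum_avg_cj_rot_mul_rot (cj Q) hP.isSolid_cj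
  have hcc : ∀ R : MvPolynomial (Fin n) ℂ, cj (cj R) = R := fun R => by
    refine ev_injective (funext fun x => ?_)
    simp [ev_cj]
  simp only [← cj_rot, hcc] at h2
  simp only [mul_comm _ (cj _)] at h2
  rw [h1, ← sub_eq_zero, ← sub_mul, mul_eq_zero] at h2
  refine h2.resolve_left fun h => ?_
  have h3 : ((q : ℂ) - p) * (q + p + (n - 2 : ℕ)) = 0 := by
    rw [Nat.cast_sub hn.out]
    push_cast
    linear_combination h / 2
  rcases mul_eq_zero.1 h3 with h4 | h4
  · exact hpq (by exact_mod_cast (sub_eq_zero.1 h4).symm)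
  · have : q + p + (n - 2) = 0 := by exact_mod_cast h4
    omega

lemma nrm_sum {P : ℕ → MvPolynomial (Fin n) ℂ} (hP : ∀ p, IsSolid p (P p)) (s : Finset ℕ) :
    nrm (∑ p ∈ s, P p) = ∑ p ∈ s, nrm (P p) := by
  have h : avg (cj (∑ p ∈ s, P p) * ∑ p ∈ s, P p) = ∑ p ∈ s, avg (cj (P p) * P p) := by
    rw [cj, map_sum, Finset.sum_mul_sum, avg_sum]
    refine Finset.sum_congr rfl fun p hp => ?_
    rw [avg_sum, Finset.sum_eq_single p]
    · rfl
    · exact fun q _ hq => (hP p).avg_cj_mul_eq_zero (hP q) hq.symm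
    · exact fun h => absurd hp h
  simp only [avg_cj_mul_self] at h
  exact_mod_cast h

/-- Average the Casimir identity for `|P|²`, homogeneous of degree `2p`: the left side has mean
zero, while harmonicity reduces `Δ|P|²` to `2 ∑ |∂_k P|²`. -/
lemma IsSolid.sum_nrm_pderiv {p : ℕ} {P : MvPolynomial (Fin n) ℂ} (hP : IsSolid p P) :
    ∑ k, nrm (pderiv k P) = p * (2 * p + n - 2) * nrm P := by
  have hu : (cj P * P).IsHomogeneous (p + p) := hP.isSolid_cj.1.mul hP.1
  have h := congrArg avg (sum_rot_rot hu)
  rw [lap_mul, hP.2, hP.isSolid_cj.2, ← smul_eq_C_mul, avg_sub, avg_smul, avg_sum] at h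
  simp only [avg_sum, avg_rot, Finset.sum_const_zero, zero_mul, mul_zero, add_zero, zero_add] at h
  have h2 : ∀ Q : MvPolynomial (Fin n) ℂ, 2 * Q = (2 : ℂ) • Q := fun Q => by
    rw [smul_eq_C_mul, map_ofNat]
  rw [h2, h2, mul_smul_comm, avg_smul, avg_smul, avg_sqNorm_mul, avg_sum] at h
  simp only [← cj_pderiv, avg_cj_mul_self] at h
  push_cast at h
  have h3 : (∑ k, (nrm (pderiv k P) : ℂ)) = p * (2 * p + n - 2) * nrm P := by
    linear_combination -h / 4
  exact_mod_cast h3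

end SphereNorm

/-! ### Polar coordinates -/

section Polar

variable {n : ℕ}

/-- The surface area of the unit sphere. -/
def surf (n : ℕ) : ℝ≥0∞ := (volume : Measure (E n)).toSphere Set.univ

lemma surf_ne_top : surf n ≠ ∞ := measure_ne_top _ _

variable [hn : Fact (2 ≤ n)]

lemma surf_ne_zero : surf n ≠ 0 := Measure.measure_univ_ne_zero.2 (Measure.toSphere_ne_zero _)

lemma toSphere_eq : (volume : Measure (E n)).toSphere = surf n • sphereMeasure n := by
  rw [sphereMeasure, smul_smul]
  change _ = (surf n * (surf n)⁻¹) • _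
  rw [ENNReal.mul_inv_cancel surf_ne_zero surf_ne_top, one_smul]

/-- Integration in polar coordinates. -/
lemma lintegral_polar {g : E n → ℝ≥0∞} (hg : Measurable g) :
    ∫⁻ x, g x = surf n * ∫⁻ r in Set.Ioi (0 : ℝ), ENNReal.ofReal (r ^ (n - 1)) *
      ∫⁻ ζ : sphere (0 : E n) 1, g (r • (ζ : E n)) ∂(sphereMeasure n) := by
  have hm : Measurable fun q : sphere (0 : E n) 1 × Set.Ioi (0 : ℝ) =>
      g ((q.2 : ℝ) • (q.1 : E n)) := hg.comp (by fun_prop)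
  have hm2 : Measurable fun r : ℝ => ∫⁻ ζ : sphere (0 : E n) 1, g (r • (ζ : E n))
      ∂(sphereMeasure n) := by
    refine Measurable.lintegral_prod_right' (f := fun q : ℝ × sphere (0 : E n) 1 => g (q.1 • (q.2 : E n))) ?_
    exact hg.comp (by fun_prop)
  have h1 : ∫⁻ x, g x = ∫⁻ x : ({0}ᶜ : Set (E n)), g x
      ∂((volume : Measure (E n)).comap (↑)) := by
    rw [lintegral_subtype_comap (measurableSet_singleton _).compl, restrict_compl_singleton]
  have h2 := ((volume : Measure (E n)).measurePreserving_homeomorphUnitSphereProd).lintegral_comp hm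
  have h3 : ∀ x : ({0}ᶜ : Set (E n)), ((homeomorphUnitSphereProd (E n) x).2 : ℝ) •
      ((homeomorphUnitSphereProd (E n) x).1 : E n) = x := by
    intro x
    have : ‖(x : E n)‖ ≠ 0 := norm_ne_zero_iff.2 x.2
    simp [smul_smul, this]
  simp only [h3] at h2
  rw [h1, h2, lintegral_prod_symm _ hm.aemeasurable, Measure.volumeIoiPow,
    lintegral_withDensity_eq_lintegral_mul _ (by fun_prop)]
  · simp only [Pi.mul_apply, toSphere_eq, lintegral_smul_measure, smul_eq_mul, finrank_euclideanSpace,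
      Fintype.card_fin]
    rw [lintegral_subtype_comap measurableSet_Ioi (fun r : ℝ => ENNReal.ofReal (r ^ (n - 1)) *
      (surf n * ∫⁻ ζ : sphere (0 : E n) 1, g (r • (ζ : E n)) ∂(sphereMeasure n))),
      ← lintegral_const_mul _ (by fun_prop)]
    refine lintegral_congr fun r => by ring
  · simp only [toSphere_eq, lintegral_smul_measure, smul_eq_mul]
    exact (hm2.comp measurable_subtype_coe).const_mul _

lemma setLIntegral_ball_polar {g : E n → ℝ≥0∞} (hg : Measurable g) (R : ℝ) :
    ∫⁻ x in ball (0 : E n) R, g x = surf n * ∫⁻ r in Set.Ioo (0 : ℝ) R,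
      ENNReal.ofReal (r ^ (n - 1)) *
      ∫⁻ ζ : sphere (0 : E n) 1, g (r • (ζ : E n)) ∂(sphereMeasure n) := by
  rw [← lintegral_indicator measurableSet_ball, lintegral_polar (hg.indicator measurableSet_ball)]
  congr 1
  have : Set.Ioo (0 : ℝ) R = Set.Iio R ∩ Set.Ioi 0 := by ext; simp [and_comm]
  rw [this, ← Measure.restrict_restrict measurableSet_Iio, ← lintegral_indicator measurableSet_Iio]
  refine setLIntegral_congr_fun measurableSet_Ioi fun r (hr : 0 < r) => ?_
  have hmem : ∀ ζ : sphere (0 : E n) 1, r • (ζ : E n) ∈ ball (0 : E n) R ↔ r < R := fun ζ => by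
    simp [norm_smul, abs_of_pos hr]
  by_cases h : r < R
  · simp [Set.indicator, h, norm_smul, abs_of_pos hr]
  · simp [Set.indicator, h, norm_smul, abs_of_pos hr]

lemma setLIntegral_ball_mono {f g : E n → ℝ≥0∞} (hf : Measurable f) (hg : Measurable g) {R : ℝ}
    (h : ∀ r, 0 < r → r < R → ∫⁻ ζ : sphere (0 : E n) 1, f (r • (ζ : E n)) ∂(sphereMeasure n) ≤
      ∫⁻ ζ : sphere (0 : E n) 1, g (r • (ζ : E n)) ∂(sphereMeasure n)) :
    ∫⁻ x in ball (0 : E n) R, f x ≤ ∫⁻ x in ball (0 : E n) R, g x := by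
  rw [setLIntegral_ball_polar hf, setLIntegral_ball_polar hg]
  gcongr 1
  refine setLIntegral_mono' measurableSet_Ioo fun r hr => ?_
  gcongr 1
  exact h r hr.1 hr.2

end Polar

/-! ### Mean value inequality and pointwise bounds for solid harmonics -/

section PointwiseBound

open MvPolynomial

variable {n : ℕ}

lemma pderiv_homogeneousComponent_succ (p : ℕ) (k : Fin n) (Q : MvPolynomial (Fin n) ℂ) :
    pderiv k (homogeneousComponent (p + 1) Q) = homogeneousComponent p (pderiv k Q) := by
  ext d
  simp only [coeff_pderiv, coeff_homogeneousComponent, map_add, Finsupp.degree_single,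
    add_left_inj]
  split_ifs <;> simp

lemma lap_homogeneousComponent_add_two (p : ℕ) (Q : MvPolynomial (Fin n) ℂ) :
    lap (homogeneousComponent (p + 2) Q) = homogeneousComponent p (lap Q) := by
  simp [lap, pderiv_homogeneousComponent_succ]

/-- The Laplacian lowers the grading by two, so it kills every component of a harmonic polynomial;
degrees 0 and 1 are harmonic anyway. -/
lemma isSolid_homogeneousComponent {Q : MvPolynomial (Fin n) ℂ} (hQ : lap Q = 0) (p : ℕ) :
    IsSolid p (homogeneousComponent p Q) := by
  refine ⟨homogeneousComponent_isHomogeneous p Q, ?_⟩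
  rcases p with _ | _ | p
  · simp [lap, homogeneousComponent_zero]
  · simp [lap, pderiv_homogeneousComponent_succ, homogeneousComponent_zero]
  · rw [lap_homogeneousComponent_add_two, hQ, map_zero]

/-- The polynomial `y ↦ P (x + t y)`. -/
def affineComp (P : MvPolynomial (Fin n) ℂ) (x : E n) (t : ℝ) : MvPolynomial (Fin n) ℂ :=
  bind₁ (fun i => C (x i : ℂ) + C (t : ℂ) * X i) P

lemma ev_affineComp (P : MvPolynomial (Fin n) ℂ) (x : E n) (t : ℝ) (y : E n) :
    ev (affineComp P x t) y = ev P (x + t • y) := by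
  simp only [ev, affineComp]
  induction P using MvPolynomial.induction_on with
  | C a => simp
  | add p q hp hq => simp_all
  | mul_X p i hp => simp_all

lemma pderiv_affineComp (P : MvPolynomial (Fin n) ℂ) (x : E n) (t : ℝ) (k : Fin n) :
    pderiv k (affineComp P x t) = C (t : ℂ) * affineComp (pderiv k P) x t := by
  classical
  simp only [affineComp]
  induction P using MvPolynomial.induction_on with
  | C a => simp
  | add p q hp hq => simp only [map_add, hp, hq, mul_add]
  | mul_X p i hp =>
    simp only [map_mul, map_add, Derivation.leibniz, hp, bind₁_X_right, smul_eq_mul, pderiv_C,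
      pderiv_X, Pi.single_apply]
    by_cases h : i = k <;> simp [h] <;> ring

lemma lap_affineComp (P : MvPolynomial (Fin n) ℂ) (x : E n) (t : ℝ) :
    lap (affineComp P x t) = C ((t : ℂ) ^ 2) * affineComp (lap P) x t := by
  simp only [lap, pderiv_affineComp, pderiv_C_mul, ← mul_assoc, ← Finset.mul_sum]
  simp [affineComp, pow_two]

variable [hn : Fact (2 ≤ n)]

lemma sum_nrm_homogeneousComponent {Q : MvPolynomial (Fin n) ℂ} (hQ : lap Q = 0) :
    nrm Q = ∑ p ∈ Finset.range (Q.totalDegree + 1), nrm (homogeneousComponent p Q) := by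
  conv_lhs => rw [← sum_homogeneousComponent Q]
  exact nrm_sum (isSolid_homogeneousComponent hQ) _

lemma nrm_homogeneousComponent_le {Q : MvPolynomial (Fin n) ℂ} (hQ : lap Q = 0) (p : ℕ) :
    nrm (homogeneousComponent p Q) ≤ nrm Q := by
  by_cases h : p ≤ Q.totalDegree
  · rw [sum_nrm_homogeneousComponent hQ]
    exact Finset.single_le_sum (f := fun p => nrm (homogeneousComponent p Q))
      (fun _ _ => nrm_nonneg _) (Finset.mem_range.2 (by omega))
  · rw [homogeneousComponent_eq_zero _ _ (not_le.1 h)]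
    simpa [nrm] using nrm_nonneg Q

/-- The value at the origin is the component of degree 0, whose norm is at most that of `Q` by
orthogonality. -/
lemma norm_ev_zero_sq_le {Q : MvPolynomial (Fin n) ℂ} (hQ : lap Q = 0) :
    ‖ev Q 0‖ ^ 2 ≤ nrm Q := by
  refine le_trans (le_of_eq ?_) (nrm_homogeneousComponent_le hQ 0)
  have : ev Q 0 = coeff 0 Q := by
    simp only [ev, PiLp.zero_apply, Complex.ofReal_zero]
    exact congrFun (congrArg _ (eval_zero (R := ℂ) (σ := Fin n))) Q
  simp [nrm, this, homogeneousComponent_zero]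

lemma enorm_ev_sq_le_lintegral {P : MvPolynomial (Fin n) ℂ} (hP : lap P = 0) (x : E n) (t : ℝ) :
    ‖ev P x‖ₑ ^ 2 ≤ ∫⁻ ζ : sphere (0 : E n) 1, ‖ev P (x + t • (ζ : E n))‖ₑ ^ 2
      ∂(sphereMeasure n) := by
  have h := norm_ev_zero_sq_le (Q := affineComp P x t) (by rw [lap_affineComp, hP]; simp [affineComp])
  have h2 := sphereNormSq_ev (affineComp P x t)
  simp only [sphereNormSq, ev_affineComp, smul_zero, add_zero] at h h2
  rw [h2, ← ofReal_norm, ← ENNReal.ofReal_pow (norm_nonneg _)]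
  exact ENNReal.ofReal_le_ofReal h

/-- Sub-mean-value property of `|P|²` over the ball of radius `δ` about `x`, which lies in the unit
ball. There homogeneity bounds each spherical mean by the one at radius 1. The quotient of the two
volumes is `δ^n`. -/
lemma IsSolid.norm_ev_sq_mul_le {p : ℕ} {P : MvPolynomial (Fin n) ℂ} (hP : IsSolid p P)
    {δ : ℝ} (hδ : 0 < δ) {x : E n} (hx : ‖x‖ + δ ≤ 1) : ‖ev P x‖ ^ 2 * δ ^ n ≤ nrm P := by
  have hm : Measurable fun y : E n => ‖ev P y‖ₑ ^ 2 := (continuous_ev P).measurable.enorm.pow_const 2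
  have h1 : ‖ev P x‖ₑ ^ 2 * volume (ball (0 : E n) δ) ≤
      ∫⁻ y in ball (0 : E n) δ, ‖ev P (x + y)‖ₑ ^ 2 := by
    rw [← setLIntegral_const]
    refine setLIntegral_ball_mono measurable_const (hm.comp (by fun_prop)) fun r _ _ => ?_
    simpa using enorm_ev_sq_le_lintegral hP.2 x r
  have h2 : ∫⁻ y in ball (0 : E n) δ, ‖ev P (x + y)‖ₑ ^ 2 ≤
      ∫⁻ y in ball (0 : E n) 1, ‖ev P y‖ₑ ^ 2 := by
    rw [← lintegral_indicator measurableSet_ball, ← lintegral_indicator measurableSet_ball,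
      ← lintegral_add_left_eq_self ((ball (0 : E n) 1).indicator fun y => ‖ev P y‖ₑ ^ 2) x]
    refine lintegral_mono fun y => ?_
    by_cases hy : y ∈ ball (0 : E n) δ
    · have : x + y ∈ ball (0 : E n) 1 := by
        rw [mem_ball_zero_iff] at hy ⊢
        exact (norm_add_le x y).trans_lt (by linarith)
      simp only [Set.indicator_of_mem hy, Set.indicator_of_mem this, le_refl]
    · simp only [Set.indicator_of_notMem hy, zero_le]
  have h3 : ∫⁻ y in ball (0 : E n) 1, ‖ev P y‖ₑ ^ 2 ≤
      ENNReal.ofReal (nrm P) * volume (ball (0 : E n) 1) := by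
    rw [← setLIntegral_const]
    refine setLIntegral_ball_mono hm measurable_const fun r hr0 hr1 => ?_
    rw [← sphereNormSq_ev, sphereNormSq]
    simp only [ev_real_smul hP.1, enorm_mul, mul_pow, lintegral_const, measure_univ, mul_one]
    refine lintegral_mono fun ζ => ?_
    refine mul_le_of_le_one_left' ?_
    refine pow_le_one₀ zero_le ?_
    rw [← ofReal_norm, ENNReal.ofReal_le_one]
    simpa [abs_of_pos hr0] using pow_le_one₀ hr0.le hr1.le
  have h4 := (h1.trans h2).trans h3
  rw [Measure.addHaar_ball_of_pos _ _ hδ, ← mul_assoc, ENNReal.mul_le_mul_iff_left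
    (measure_ball_pos _ _ one_pos).ne' measure_ball_lt_top.ne, finrank_euclideanSpace,
    Fintype.card_fin, ← ofReal_norm, ← ENNReal.ofReal_pow (norm_nonneg _),
    ← ENNReal.ofReal_mul (by positivity), ENNReal.ofReal_le_ofReal_iff (nrm_nonneg _)] at h4
  exact h4

end PointwiseBound

/-! ### Geometric decay inside the ball, also for derivatives -/

section Bounds

open MvPolynomial

variable {n : ℕ}

lemma nrm_smul (c : ℂ) (P : MvPolynomial (Fin n) ℂ) : nrm (c • P) = ‖c‖ ^ 2 * nrm P := by
  simp only [nrm, ev_smul, norm_mul, mul_pow]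
  exact integral_const_mul _ _

lemma IsSolid.smul {p : ℕ} {P : MvPolynomial (Fin n) ℂ} (hP : IsSolid p P) (c : ℂ) :
    IsSolid p (c • P) :=
  ⟨by rw [smul_eq_C_mul]; exact hP.1.C_mul c, by rw [lap_smul, hP.2, smul_zero]⟩

lemma exists_mul_pow_le {s t : ℝ} (hs : 0 < s) (hst : s < t) :
    ∃ C : ℝ, 0 ≤ C ∧ ∀ p : ℕ, (p : ℝ) * s ^ p ≤ C * t ^ p := by
  have ht : 0 < t := hs.trans hst
  have h := (tendsto_self_mul_const_pow_of_lt_one (r := s / t) (by positivity)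
    ((div_lt_one ht).2 hst)).bddAbove_range
  obtain ⟨C, hC⟩ := h
  refine ⟨max C 0, le_max_right _ _, fun p => ?_⟩
  have h1 : (p : ℝ) * (s / t) ^ p ≤ max C 0 := le_max_of_le_left (hC ⟨p, rfl⟩)
  rw [div_pow, ← mul_div_assoc, div_le_iff₀ (by positivity)] at h1
  exact h1

variable [hn : Fact (2 ≤ n)]

/-- Apply the pointwise bound at `x / s` with `r < s < 1`, at a positive distance from the sphere,
and let homogeneity supply the factor `s ^ p`. -/
lemma exists_norm_ev_le {r : ℝ} (hr0 : 0 ≤ r) (hr : r < 1) :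
    ∃ s : ℝ, 0 < s ∧ s < 1 ∧ ∃ K : ℝ, 0 ≤ K ∧ ∀ (p : ℕ) (P : MvPolynomial (Fin n) ℂ),
      IsSolid p P → ∀ x : E n, ‖x‖ ≤ r → ‖ev P x‖ ≤ K * (s ^ p * √(nrm P)) := by
  set s := (1 + r) / 2 with hs
  have hs0 : 0 < s := by positivity
  have hs1 : s < 1 := by rw [hs]; linarith
  have hrs : r < s := by rw [hs]; linarith
  -- The room between the point `x / s`, of norm at most `r / s`, and the unit sphere.
  set δ := 1 - r / s with hδ
  have hδ0 : 0 < δ := by rw [hδ, sub_pos, div_lt_one hs0]; exact hrs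
  refine ⟨s, hs0, hs1, √(δ ^ n)⁻¹, by positivity, fun p P hP x hx => ?_⟩
  have h1 : x = s • (s⁻¹ • x) := by rw [smul_smul, mul_inv_cancel₀ hs0.ne', one_smul]
  have h2 : ‖s⁻¹ • x‖ + δ ≤ 1 := by
    rw [norm_smul, Real.norm_of_nonneg (by positivity), hδ, inv_mul_eq_div]
    have : ‖x‖ / s ≤ r / s := by gcongr
    linarith
  have h3 := hP.norm_ev_sq_mul_le hδ0 h2
  have h4 : ‖ev P (s⁻¹ • x)‖ ≤ √(δ ^ n)⁻¹ * √(nrm P) := by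
    rw [← Real.sqrt_mul (by positivity)]
    refine Real.le_sqrt_of_sq_le ?_
    rw [inv_mul_eq_div, le_div_iff₀ (by positivity)]
    exact h3
  rw [h1, ev_real_smul hP.1, norm_mul, norm_pow, Complex.norm_real, Real.norm_of_nonneg hs0.le]
  calc s ^ p * ‖ev P (s⁻¹ • x)‖ ≤ s ^ p * (√(δ ^ n)⁻¹ * √(nrm P)) := by gcongr
    _ = _ := by ring

/-- A crude linear growth in `p` suffices, since any geometric factor absorbs it. -/
lemma IsSolid.sqrt_nrm_pderiv_le {p : ℕ} {P : MvPolynomial (Fin n) ℂ} (hP : IsSolid p P)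
    (k : Fin n) : √(nrm (pderiv k P)) ≤ (n + 2) * p * √(nrm P) := by
  have h : nrm (pderiv k P) ≤ p * (2 * p + n - 2) * nrm P := by
    rw [← hP.sum_nrm_pderiv]
    exact Finset.single_le_sum (f := fun k => nrm (pderiv k P)) (fun _ _ => nrm_nonneg _)
      (Finset.mem_univ k)
  rw [← Real.sqrt_sq (by positivity : (0 : ℝ) ≤ (n + 2) * p), ← Real.sqrt_mul (by positivity)]
  refine Real.sqrt_le_sqrt (h.trans ?_)
  refine mul_le_mul_of_nonneg_right ?_ (nrm_nonneg _)
  rcases Nat.eq_zero_or_pos p with rfl | hp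
  · simp
  · have hp' : (1 : ℝ) ≤ p := by exact_mod_cast hp
    have hn' : (2 : ℝ) ≤ n := by exact_mod_cast hn.out
    nlinarith [mul_nonneg (sub_nonneg.2 hp') (sub_nonneg.2 hn'), sq_nonneg ((p : ℝ) * n)]

lemma IsSolid.sqrt_nrm_rot_le {p : ℕ} {P : MvPolynomial (Fin n) ℂ} (hP : IsSolid p P)
    (j k : Fin n) : √(nrm (rot j k P)) ≤ (n + 2) * p * √(nrm P) := by
  have h : nrm (rot j k P) ≤ 2 * (p * (p + n - 2)) * nrm P := by
    rw [← hP.sum_nrm_rot]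
    refine (Finset.single_le_sum (f := fun k => nrm (rot j k P)) (fun _ _ => nrm_nonneg _)
      (Finset.mem_univ k)).trans ?_
    exact Finset.single_le_sum (f := fun j => ∑ k, nrm (rot j k P))
      (fun _ _ => Finset.sum_nonneg fun _ _ => nrm_nonneg _) (Finset.mem_univ j)
  rw [← Real.sqrt_sq (by positivity : (0 : ℝ) ≤ (n + 2) * p), ← Real.sqrt_mul (by positivity)]
  refine Real.sqrt_le_sqrt (h.trans ?_)
  refine mul_le_mul_of_nonneg_right ?_ (nrm_nonneg _)
  rcases Nat.eq_zero_or_pos p with rfl | hp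
  · simp
  · have hp' : (1 : ℝ) ≤ p := by exact_mod_cast hp
    have hn' : (2 : ℝ) ≤ n := by exact_mod_cast hn.out
    nlinarith [mul_nonneg (sub_nonneg.2 hp') (sub_nonneg.2 hn'), sq_nonneg ((p : ℝ) * n),
      mul_nonneg (mul_nonneg (sub_nonneg.2 hp') (sub_nonneg.2 hn')) (sub_nonneg.2 hp')]

lemma exists_norm_fderiv_ev_le {r : ℝ} (hr0 : 0 ≤ r) (hr : r < 1) :
    ∃ s : ℝ, 0 < s ∧ s < 1 ∧ ∃ K : ℝ, 0 ≤ K ∧ ∀ (p : ℕ) (P : MvPolynomial (Fin n) ℂ),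
      IsSolid p P → ∀ x : E n, ‖x‖ ≤ r → ‖fderiv ℝ (ev P) x‖ ≤ K * (s ^ p * √(nrm P)) := by
  obtain ⟨s, hs0, hs1, K, hK, hb⟩ := exists_norm_ev_le (n := n) hr0 hr
  obtain ⟨t, hst, ht1⟩ := exists_between hs1
  obtain ⟨C, hC, hCb⟩ := exists_mul_pow_le hs0 hst
  refine ⟨t, hs0.trans hst, ht1, n * (K * (s⁻¹ * (n + 2) * C)), by positivity,
    fun p P hP x hx => ?_⟩
  have h1 : ∀ k : Fin n, ‖ev (pderiv k P) x‖ ≤ K * (s⁻¹ * (n + 2) * C) * (t ^ p * √(nrm P)) := by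
    intro k
    -- In degree 0 the truncated degree `p - 1` would spoil the exponent below, but there the
    -- derivative vanishes.
    rcases p with _ | p
    · rw [pderiv_eq_zero_of_isHomogeneous_zero hP.1, ev_zero, norm_zero]
      positivity
    calc ‖ev (pderiv k P) x‖ ≤ K * (s ^ p * √(nrm (pderiv k P))) := hb _ _ (hP.isSolid_pderiv k) x hx
      _ ≤ K * (s ^ p * ((n + 2) * (p + 1 : ℕ) * √(nrm P))) := by
        gcongr
        exact hP.sqrt_nrm_pderiv_le k
      _ = K * (s⁻¹ * (n + 2)) * (((p + 1 : ℕ) * s ^ (p + 1)) * √(nrm P)) := by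
        field_simp
        ring
      _ ≤ K * (s⁻¹ * (n + 2)) * ((C * t ^ (p + 1)) * √(nrm P)) := by
        gcongr K * (s⁻¹ * (n + 2)) * (?_ * √(nrm P))
        exact hCb _
      _ = _ := by ring
  have h2 : ∀ k : Fin n, ‖(EuclideanSpace.proj k : E n →L[ℝ] ℝ)‖ ≤ 1 := fun k =>
    ContinuousLinearMap.opNorm_le_bound _ zero_le_one fun v => by
      simpa using PiLp.norm_apply_le v k
  rw [(hasFDerivAt_ev P x).fderiv]
  calc _ ≤ ∑ k : Fin n, ‖(EuclideanSpace.proj k : E n →L[ℝ] ℝ).smulRight (ev (pderiv k P) x)‖ :=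
        norm_sum_le _ _
    _ ≤ ∑ k : Fin n, K * (s⁻¹ * (n + 2) * C) * (t ^ p * √(nrm P)) := by
        refine Finset.sum_le_sum fun k _ => ?_
        rw [ContinuousLinearMap.norm_smulRight_apply]
        exact (mul_le_of_le_one_left (norm_nonneg _) (h2 k)).trans (h1 k)
    _ = _ := by simp; ring

end Bounds

/-! ### Term-by-term differentiation of expansions -/

section Series

open MvPolynomial

variable {n : ℕ}

/-- A sequence of solid harmonics whose sum converges absolutely and locally uniformly on the
unit ball. -/
structure IsGood (P : ℕ → MvPolynomial (Fin n) ℂ) : Prop where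
  solid : ∀ p, IsSolid p (P p)
  summable : ∀ s : ℝ, 0 < s → s < 1 → Summable fun p => s ^ p * √(nrm (P p))

/-- The sum of a series of polynomials. -/
def seriesSum (P : ℕ → MvPolynomial (Fin n) ℂ) (x : E n) : ℂ := ∑' p, ev (P p) x

/-- Iterated formal rotational derivatives. -/
def rotList (l : List (PairIndex n)) (P : MvPolynomial (Fin n) ℂ) : MvPolynomial (Fin n) ℂ :=
  l.foldr (fun a Q => rot a.1.1 a.1.2 Q) P

lemma tangential_congr {f g : E n → ℂ} {U : Set (E n)} (hU : IsOpen U) (h : Set.EqOn f g U)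
    (a : PairIndex n) : Set.EqOn (tangential n a f) (tangential n a g) U := by
  intro x hx
  have : f =ᶠ[𝓝 x] g := h.eventuallyEq_of_mem (hU.mem_nhds hx)
  simp [tangential, partialDeriv, this.fderiv_eq]

lemma tendstoLocallyUniformlyOn_ball_iff {F : ℕ → E n → ℂ} {f : E n → ℂ} :
    TendstoLocallyUniformlyOn F f atTop (ball (0 : E n) 1) ↔
      ∀ r < 1, TendstoUniformlyOn F f atTop (closedBall (0 : E n) r) := by
  rw [tendstoLocallyUniformlyOn_iff_forall_isCompact isOpen_ball]
  constructor
  · intro h r hr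
    exact h _ (closedBall_subset_ball hr) (isCompact_closedBall _ _)
  · intro h K hK hKc
    obtain ⟨r, hr, hKr⟩ := exists_lt_subset_ball hKc.isClosed hK
    exact (h r hr).mono (hKr.trans ball_subset_closedBall)

variable [hn : Fact (2 ≤ n)]

/-- The factor `p` lost to a derivative is absorbed by enlarging the radius from `s` to `t < 1`. -/
lemma IsGood.rot {P : ℕ → MvPolynomial (Fin n) ℂ} (hP : IsGood P) (j k : Fin n) :
    IsGood fun p => HarmonicDirichlet.rot j k (P p) := by
  refine ⟨fun p => (hP.solid p).isSolid_rot j k, fun s hs0 hs1 => ?_⟩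
  obtain ⟨t, hst, ht1⟩ := exists_between hs1
  obtain ⟨C, hC, hCb⟩ := exists_mul_pow_le hs0 hst
  refine Summable.of_nonneg_of_le (fun _ => by positivity) (fun p => ?_)
    ((hP.summable t (hs0.trans hst) ht1).mul_left ((n + 2) * C))
  calc _ ≤ s ^ p * ((n + 2) * p * √(nrm (P p))) := by
        gcongr
        exact (hP.solid p).sqrt_nrm_rot_le j k
    _ = (n + 2) * (p * s ^ p) * √(nrm (P p)) := by ring
    _ ≤ (n + 2) * (C * t ^ p) * √(nrm (P p)) := by
        gcongr (n + 2) * ?_ * √(nrm (P p))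
        exact hCb p
    _ = _ := by ring

lemma IsGood.rotList {P : ℕ → MvPolynomial (Fin n) ℂ} (hP : IsGood P) (l : List (PairIndex n)) :
    IsGood fun p => HarmonicDirichlet.rotList l (P p) := by
  induction l with
  | nil => exact hP
  | cons a l ih => exact ih.rot a.1.1 a.1.2

lemma IsGood.exists_summable_bound {P : ℕ → MvPolynomial (Fin n) ℂ} (hP : IsGood P) {r : ℝ}
    (hr0 : 0 ≤ r) (hr : r < 1) : ∃ u : ℕ → ℝ, Summable u ∧
      ∀ p, ∀ x : E n, ‖x‖ ≤ r → ‖ev (P p) x‖ ≤ u p := by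
  obtain ⟨s, hs0, hs1, K, hK, hb⟩ := exists_norm_ev_le (n := n) hr0 hr
  exact ⟨_, (hP.summable s hs0 hs1).mul_left K, fun p x hx => hb p _ (hP.solid p) x hx⟩

lemma IsGood.exists_summable_bound_fderiv {P : ℕ → MvPolynomial (Fin n) ℂ} (hP : IsGood P) {r : ℝ}
    (hr0 : 0 ≤ r) (hr : r < 1) : ∃ u : ℕ → ℝ, Summable u ∧
      ∀ p, ∀ x : E n, ‖x‖ ≤ r → ‖fderiv ℝ (ev (P p)) x‖ ≤ u p := by
  obtain ⟨s, hs0, hs1, K, hK, hb⟩ := exists_norm_fderiv_ev_le (n := n) hr0 hr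
  exact ⟨_, (hP.summable s hs0 hs1).mul_left K, fun p x hx => hb p _ (hP.solid p) x hx⟩

lemma IsGood.summable_ev {P : ℕ → MvPolynomial (Fin n) ℂ} (hP : IsGood P) {x : E n}
    (hx : ‖x‖ < 1) : Summable fun p => ev (P p) x := by
  obtain ⟨u, hu, hb⟩ := hP.exists_summable_bound (norm_nonneg x) hx
  exact Summable.of_norm_bounded hu fun p => hb p x le_rfl

lemma IsGood.hasFDerivAt {P : ℕ → MvPolynomial (Fin n) ℂ} (hP : IsGood P) {x : E n}
    (hx : ‖x‖ < 1) : Summable (fun p => fderiv ℝ (ev (P p)) x) ∧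
      HasFDerivAt (seriesSum P) (∑' p, fderiv ℝ (ev (P p)) x) x := by
  obtain ⟨r, hxr, hr1⟩ := exists_between hx
  obtain ⟨u, hu, hb⟩ := hP.exists_summable_bound_fderiv ((norm_nonneg x).trans hxr.le) hr1
  refine ⟨Summable.of_norm_bounded hu fun p => hb p x hxr.le, ?_⟩
  exact hasFDerivAt_tsum_of_isPreconnected (s := ball (0 : E n) r) (x₀ := x) hu isOpen_ball
    (convex_ball _ _).isPreconnected
    (fun p y _ => ((contDiff_ev (P p) (m := 1)).differentiable (by norm_num) y).hasFDerivAt)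
    (fun p y hy => hb p y (mem_ball_zero_iff.1 hy).le) (by simpa using hxr) (hP.summable_ev hx)
    (by simpa using hxr)

lemma IsGood.tangential_seriesSum {P : ℕ → MvPolynomial (Fin n) ℂ} (hP : IsGood P)
    (a : PairIndex n) : Set.EqOn (tangential n a (seriesSum P))
      (seriesSum fun p => HarmonicDirichlet.rot a.1.1 a.1.2 (P p)) (ball 0 1) := by
  intro x hx
  have hx' : ‖x‖ < 1 := by simpa using hx
  obtain ⟨h1, h2⟩ := hP.hasFDerivAt hx'
  have h3 : ∀ v : E n, HasSum (fun p => fderiv ℝ (ev (P p)) x v) (fderiv ℝ (seriesSum P) x v) := by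
    intro v
    rw [h2.fderiv]
    exact ((ContinuousLinearMap.apply ℝ ℂ v).hasSum h1.hasSum)
  simp only [tangential, partialDeriv, seriesSum, ← tangential_ev]
  exact (((h3 _).mul_left _).sub ((h3 _).mul_left _)).tsum_eq.symm

/-- Induction on the number of fields; derivatives are local, so knowing `f` on the open ball is
enough. -/
lemma IsGood.eqOn_foldr_tangential {P : ℕ → MvPolynomial (Fin n) ℂ} (hP : IsGood P) {f : E n → ℂ}
    (hf : Set.EqOn f (seriesSum P) (ball 0 1)) (l : List (PairIndex n)) :
    Set.EqOn (l.foldr (tangential n) f)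
      (seriesSum fun p => HarmonicDirichlet.rotList l (P p)) (ball 0 1) := by
  induction l with
  | nil => exact hf
  | cons a l ih =>
    exact (tangential_congr isOpen_ball ih a).trans ((hP.rotList l).tangential_seriesSum a)

end Series

/-! ### Parseval on spheres and balls; uniqueness of the expansion -/

section Parseval

open MvPolynomial

variable {n : ℕ}

lemma IsSolid.add {p : ℕ} {P Q : MvPolynomial (Fin n) ℂ} (hP : IsSolid p P) (hQ : IsSolid p Q) :
    IsSolid p (P + Q) :=
  ⟨hP.1.add hQ.1, by rw [lap_add, hP.2, hQ.2, add_zero]⟩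

lemma sum_ev_real_smul {P : ℕ → MvPolynomial (Fin n) ℂ} (hP : ∀ p, IsSolid p (P p)) (s : Finset ℕ)
    (r : ℝ) (x : E n) :
    ∑ p ∈ s, ev (P p) (r • x) = ev (∑ p ∈ s, ((r : ℂ) ^ p) • P p) x := by
  simp [ev_real_smul (hP _).1]

lemma IsHarmonicExpansion.add {f g : E n → ℂ} {F G : ℕ → E n → ℂ} (hf : IsHarmonicExpansion n f F)
    (hg : IsHarmonicExpansion n g G) : IsHarmonicExpansion n (f + g) (F + G) := by
  refine ⟨fun p => ?_, ?_⟩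
  · obtain ⟨P, hP, hP'⟩ := isSolidHarmonic_iff.1 (hf.solid p)
    obtain ⟨Q, hQ, hQ'⟩ := isSolidHarmonic_iff.1 (hg.solid p)
    exact isSolidHarmonic_iff.2 ⟨P + Q, hP.add hQ, by ext x; simp [hP', hQ']⟩
  · have h1 := hf.tendsto
    have h2 := hg.tendsto
    rw [tendstoLocallyUniformlyOn_ball_iff] at h1 h2 ⊢
    intro r hr
    have h := (h1 r hr).add (h2 r hr)
    refine h.congr (Eventually.of_forall fun N x _ => ?_)
    simp [Finset.sum_add_distrib]

lemma IsHarmonicExpansion.smul {f : E n → ℂ} {F : ℕ → E n → ℂ} (hf : IsHarmonicExpansion n f F)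
    (c : ℂ) : IsHarmonicExpansion n (c • f) (c • F) := by
  refine ⟨fun p => ?_, ?_⟩
  · obtain ⟨P, hP, hP'⟩ := isSolidHarmonic_iff.1 (hf.solid p)
    exact isSolidHarmonic_iff.2 ⟨c • P, hP.smul c, by ext x; simp [hP']⟩
  · have h1 := hf.tendsto
    rw [tendstoLocallyUniformlyOn_ball_iff] at h1 ⊢
    intro r hr
    have h := (lipschitzWith_smul c : LipschitzWith _ fun z : ℂ => c • z).uniformContinuous
      |>.comp_tendstoUniformlyOn (h1 r hr)
    refine h.congr (Eventually.of_forall fun N x _ => ?_)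
    simp [Finset.mul_sum]

/-- The density of the measure `ρ_s` in terms of the radius. -/
def radialWeight (n : ℕ) (s r : ℝ) : ℝ≥0∞ :=
  ENNReal.ofReal (Real.Gamma ((n : ℝ) / 2 + s + 1) /
      (Real.pi ^ ((n : ℝ) / 2) * Real.Gamma (s + 1)) * (1 - r ^ 2) ^ s)

lemma measurable_radialWeight (s : ℝ) : Measurable (radialWeight n s) := by
  unfold radialWeight
  fun_prop

variable [hn : Fact (2 ≤ n)]

lemma nrm_sum_pow_smul {P : ℕ → MvPolynomial (Fin n) ℂ} (hP : ∀ p, IsSolid p (P p))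
    (s : Finset ℕ) (r : ℝ) :
    nrm (∑ p ∈ s, ((r : ℂ) ^ p) • P p) = ∑ p ∈ s, r ^ (2 * p) * nrm (P p) := by
  rw [nrm_sum fun p => (hP p).smul _]
  refine Finset.sum_congr rfl fun p _ => ?_
  rw [nrm_smul, norm_pow, Complex.norm_real, ← pow_mul, mul_comm p 2, pow_mul, pow_mul,
    Real.norm_eq_abs, sq_abs]

lemma nrm_le_of_forall_norm_le {P : MvPolynomial (Fin n) ℂ} {M : ℝ}
    (h : ∀ ζ : sphere (0 : E n) 1, ‖ev P ζ‖ ≤ M) : nrm P ≤ M ^ 2 := by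
  have hc := continuous_ev_sphere P
  calc nrm P ≤ ∫ _ : sphere (0 : E n) 1, M ^ 2 ∂(sphereMeasure n) := by
        refine integral_mono (integrable_sphere (by fun_prop)) (integrable_const _) fun ζ => ?_
        exact pow_le_pow_left₀ (norm_nonneg _) (h ζ) 2
    _ = M ^ 2 := by simp

/-- A Cauchy estimate: partial sums are bounded on the sphere of radius `r`, and orthogonality makes
`r ^ p √(nrm (P p))` no larger than their norm there. Comparison with a geometric series gives
summability at every smaller radius. -/
lemma IsHarmonicExpansion.exists_isGood {f : E n → ℂ} {F : ℕ → E n → ℂ}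
    (h : IsHarmonicExpansion n f F) : ∃ P : ℕ → MvPolynomial (Fin n) ℂ, IsGood P ∧
      (∀ p, F p = ev (P p)) ∧ Set.EqOn f (seriesSum P) (ball 0 1) := by
  choose P hP hF using fun p => isSolidHarmonic_iff.1 (h.solid p)
  have hu := tendstoLocallyUniformlyOn_ball_iff.1 h.tendsto
  simp only [hF] at hu
  have hbound : ∀ r : ℝ, 0 < r → r < 1 → ∃ M : ℝ, ∀ p, r ^ p * √(nrm (P p)) ≤ M := by
    intro r hr0 hr1
    have hcont : ContinuousOn f (closedBall 0 r) := (hu r hr1).continuousOn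
      (Eventually.of_forall fun N => (continuous_finsetSum _ fun p _ =>
        continuous_ev (P p)).continuousOn).frequently
    obtain ⟨B, hB⟩ := (isCompact_closedBall (0 : E n) r).exists_bound_of_continuousOn hcont
    have hev := Metric.tendstoUniformlyOn_iff.1 (hu r hr1) 1 one_pos
    obtain ⟨N₀, hN₀⟩ := eventually_atTop.1 hev
    have hB0 : 0 ≤ B := (norm_nonneg _).trans (hB 0 (by simp [hr0.le]))
    refine ⟨B + 1, fun p => ?_⟩
    -- The cutoff is large enough both for the partial sum to be within 1 of `f` and for it to
    -- contain degree `p`.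
    have h1 : nrm (∑ q ∈ Finset.range (max N₀ (p + 1)), ((r : ℂ) ^ q) • P q) ≤ (B + 1) ^ 2 := by
      refine nrm_le_of_forall_norm_le fun ζ => ?_
      rw [← sum_ev_real_smul hP]
      have hmem : r • (ζ : E n) ∈ closedBall (0 : E n) r := by
        simp [norm_smul, abs_of_pos hr0]
      have h2 := hN₀ _ (le_max_left N₀ (p + 1)) _ hmem
      have h3 := hB _ hmem
      rw [dist_eq_norm, norm_sub_rev] at h2
      have := norm_le_norm_add_norm_sub' (∑ q ∈ Finset.range (max N₀ (p + 1)), ev (P q) (r • (ζ : E n)))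
        (f (r • (ζ : E n)))
      linarith
    rw [nrm_sum_pow_smul hP] at h1
    have h2 : r ^ (2 * p) * nrm (P p) ≤ (B + 1) ^ 2 := (Finset.single_le_sum
      (f := fun q => r ^ (2 * q) * nrm (P q)) (fun q _ => by have := nrm_nonneg (P q); positivity)
      (Finset.mem_range.2 (lt_of_lt_of_le (Nat.lt_succ_self p) (le_max_right _ _)))).trans h1
    refine le_of_sq_le_sq ?_ (by positivity)
    rw [mul_pow, Real.sq_sqrt (nrm_nonneg _), ← pow_mul, mul_comm p 2]
    exact h2
  have hgood : IsGood P := by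
    refine ⟨hP, fun s hs0 hs1 => ?_⟩
    obtain ⟨r, hsr, hr1⟩ := exists_between hs1
    have hr0 := hs0.trans hsr
    obtain ⟨M, hM⟩ := hbound r hr0 hr1
    refine Summable.of_nonneg_of_le (fun _ => by positivity) (fun p => ?_)
      ((summable_geometric_of_lt_one (r := s / r) (by positivity)
        ((div_lt_one hr0).2 hsr)).mul_right M)
    calc s ^ p * √(nrm (P p)) = (s / r) ^ p * (r ^ p * √(nrm (P p))) := by
          rw [← mul_assoc, ← mul_pow, div_mul_cancel₀ _ hr0.ne']
      _ ≤ _ := by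
          gcongr
          exact hM p
  refine ⟨P, hgood, hF, fun x hx => ?_⟩
  have h1 := h.tendsto.tendsto_at hx
  simp only [hF] at h1
  exact tendsto_nhds_unique h1 (hgood.summable_ev (by simpa using hx)).hasSum.tendsto_sum_nat

/-- Parseval for the finite partial sums, then dominated convergence on the sphere with a constant
bound. -/
lemma IsGood.lintegral_sphere {P : ℕ → MvPolynomial (Fin n) ℂ} (hP : IsGood P) {r : ℝ}
    (hr0 : 0 < r) (hr : r < 1) :
    ∫⁻ ζ : sphere (0 : E n) 1, ‖seriesSum P (r • (ζ : E n))‖ₑ ^ 2 ∂(sphereMeasure n) =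
      ∑' p, ENNReal.ofReal (r ^ (2 * p) * nrm (P p)) := by
  have hN : ∀ N : ℕ, ∫⁻ ζ : sphere (0 : E n) 1,
      ‖∑ p ∈ Finset.range N, ev (P p) (r • (ζ : E n))‖ₑ ^ 2 ∂(sphereMeasure n) =
      ∑ p ∈ Finset.range N, ENNReal.ofReal (r ^ (2 * p) * nrm (P p)) := by
    intro N
    simp only [sum_ev_real_smul hP.solid]
    have := sphereNormSq_ev (∑ p ∈ Finset.range N, ((r : ℂ) ^ p) • P p)
    rw [sphereNormSq, nrm_sum_pow_smul hP.solid, ENNReal.ofReal_sum_of_nonneg] at this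
    · exact this
    · intro p _
      have := nrm_nonneg (P p)
      positivity
  obtain ⟨u, hu, hb⟩ := hP.exists_summable_bound hr0.le hr
  have hnorm : ∀ ζ : sphere (0 : E n) 1, ‖r • (ζ : E n)‖ = r := fun ζ => by
    simp [norm_smul, abs_of_pos hr0]
  have hu0 : ∀ p, 0 ≤ u p := fun p => (norm_nonneg _).trans (hb p 0 (by simpa using hr0.le))
  refine tendsto_nhds_unique ?_ ENNReal.summable.tendsto_sum_tsum_nat
  simp only [← hN]
  refine tendsto_lintegral_of_dominated_convergence (fun _ => ENNReal.ofReal (∑' p, u p) ^ 2)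
    (fun N => ?_) (fun N => Eventually.of_forall fun ζ => ?_) ?_ (Eventually.of_forall fun ζ => ?_)
  · have : Continuous fun ζ : sphere (0 : E n) 1 =>
        ∑ p ∈ Finset.range N, ev (P p) (r • (ζ : E n)) :=
      continuous_finsetSum _ fun p _ => (continuous_ev (P p)).comp (by fun_prop)
    exact this.measurable.enorm.pow_const 2
  · refine pow_le_pow_left₀ zero_le ?_ 2
    rw [← ofReal_norm]
    refine ENNReal.ofReal_le_ofReal ((norm_sum_le _ _).trans ?_)
    exact (Finset.sum_le_sum fun p _ => hb p _ (hnorm ζ).le).trans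
      (hu.sum_le_tsum _ fun p _ => hu0 p)
  · simp
  · have h := (hP.summable_ev (by rw [hnorm ζ]; exact hr)).hasSum.tendsto_sum_nat
    exact ((ENNReal.continuous_pow 2).tendsto _).comp h.enorm

/-- The difference of two expansions expands the zero function; Parseval on the sphere of radius 1/2
makes every term vanish. -/
lemma IsHarmonicExpansion.unique {f : E n → ℂ} {F G : ℕ → E n → ℂ}
    (hF : IsHarmonicExpansion n f F) (hG : IsHarmonicExpansion n f G) : F = G := by
  have h := hF.add (hG.smul (-1))
  obtain ⟨P, hP, hFP, hz⟩ := h.exists_isGood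
  have h1 := hP.lintegral_sphere (r := 1 / 2) (by norm_num) (by norm_num)
  have h2 : ∀ ζ : sphere (0 : E n) 1, seriesSum P ((1 / 2 : ℝ) • (ζ : E n)) = 0 := by
    intro ζ
    rw [← hz]
    · simp
    · simp [norm_smul]
      norm_num
  simp only [h2, enorm_zero, ne_eq, OfNat.ofNat_ne_zero, not_false_eq_true, zero_pow,
    lintegral_zero] at h1
  funext p
  have h3 := ENNReal.tsum_eq_zero.1 h1.symm p
  rw [ENNReal.ofReal_eq_zero] at h3
  have h4 : nrm (P p) = 0 := by
    refine le_antisymm ?_ (nrm_nonneg _)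
    by_contra hlt
    exact absurd h3 (not_le.2 (mul_pos (by positivity) (not_le.1 hlt)))
  have h5 := hFP p
  rw [(hP.solid p).eq_zero_of_nrm_eq_zero h4] at h5
  funext x
  have h6 := congrFun h5 x
  simp only [Pi.add_apply, Pi.smul_apply, ev_zero, smul_eq_mul, neg_mul, one_mul] at h6
  exact sub_eq_zero.1 (by rw [sub_eq_add_neg]; exact h6)

lemma IsHarmonicExpansion.component_eq {f : E n → ℂ} {F : ℕ → E n → ℂ}
    (hF : IsHarmonicExpansion n f F) : component n f = F :=
  IsHarmonicExpansion.unique (Classical.epsilon_spec (p := IsHarmonicExpansion n f) ⟨F, hF⟩) hF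

/-- The ratio of the squared norms on the ball and on the sphere of a solid harmonic of
degree `p`. -/
def ballWeight (n : ℕ) (s : ℝ) (p : ℕ) : ℝ≥0∞ :=
  surf n * ∫⁻ r in Set.Ioo (0 : ℝ) 1, ENNReal.ofReal (r ^ (n - 1)) *
    (radialWeight n s r * ENNReal.ofReal (r ^ (2 * p)))

lemma IsGood.ballNormSq {P : ℕ → MvPolynomial (Fin n) ℂ} (hP : IsGood P) {g : E n → ℂ}
    (hg : Set.EqOn g (seriesSum P) (ball 0 1)) (s : ℝ) :
    ballNormSq n s g = ∑' p, ballWeight n s p * ENNReal.ofReal (nrm (P p)) := by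
  have hcont : ContinuousOn (seriesSum P) (ball (0 : E n) 1) := fun x hx =>
    (hP.hasFDerivAt (by simpa using hx)).2.continuousAt.continuousWithinAt
  -- `g` is arbitrary outside the ball and need not be measurable; `G` is a measurable function
  -- agreeing with it on the ball.
  set G : E n → ℂ := (ball (0 : E n) 1).indicator (seriesSum P) with hG
  have hGm : Measurable G :=
    by classical
      rw [hG, ← Set.piecewise_eq_indicator]
      exact hcont.measurable_piecewise continuousOn_const measurableSet_ball
  have hw := (measurable_radialWeight (n := n) s)
  have hw' : Measurable fun x : E n => radialWeight n s ‖x‖ := hw.comp measurable_norm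
  change ∫⁻ x, ‖g x‖ₑ ^ 2 ∂(((volume : Measure (E n)).restrict (ball (0 : E n) 1)).withDensity
    fun x => radialWeight n s ‖x‖) = _
  rw [lintegral_withDensity_eq_lintegral_mul_non_measurable _ hw'
      (Eventually.of_forall fun _ => ENNReal.ofReal_lt_top)]
  have h1 : ∫⁻ x in ball (0 : E n) 1, ((fun x : E n => radialWeight n s ‖x‖) * fun x => ‖g x‖ₑ ^ 2) x =
      ∫⁻ x in ball (0 : E n) 1, radialWeight n s ‖x‖ * ‖G x‖ₑ ^ 2 := by
    refine setLIntegral_congr_fun measurableSet_ball fun x hx => ?_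
    simp only [Pi.mul_apply, hG, Set.indicator_of_mem hx, hg hx]
  refine h1.trans ?_
  rw [setLIntegral_ball_polar (g := fun x => radialWeight n s ‖x‖ * ‖G x‖ₑ ^ 2)
    (hw'.mul (hGm.enorm.pow_const 2))]
  have h2 : ∀ r ∈ Set.Ioo (0 : ℝ) 1, ENNReal.ofReal (r ^ (n - 1)) * ∫⁻ ζ : sphere (0 : E n) 1,
      radialWeight n s ‖r • (ζ : E n)‖ * ‖G (r • (ζ : E n))‖ₑ ^ 2 ∂(sphereMeasure n) =
      ∑' p, ENNReal.ofReal (r ^ (n - 1)) *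
        (radialWeight n s r * ENNReal.ofReal (r ^ (2 * p))) * ENNReal.ofReal (nrm (P p)) := by
    rintro r ⟨hr0, hr1⟩
    have hnorm : ∀ ζ : sphere (0 : E n) 1, ‖r • (ζ : E n)‖ = r := fun ζ => by
      simp [norm_smul, abs_of_pos hr0]
    have hGr : ∀ ζ : sphere (0 : E n) 1, G (r • (ζ : E n)) = seriesSum P (r • (ζ : E n)) :=
      fun ζ => Set.indicator_of_mem (by rw [mem_ball_zero_iff, hnorm]; exact hr1) _
    simp only [hnorm, hGr]
    rw [lintegral_const_mul' _ _ (show radialWeight n s r ≠ ∞ from ENNReal.ofReal_ne_top), hP.lintegral_sphere hr0 hr1,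
      ← ENNReal.tsum_mul_left, ← ENNReal.tsum_mul_left]
    refine tsum_congr fun p => ?_
    rw [ENNReal.ofReal_mul (by positivity)]
    ring
  rw [setLIntegral_congr_fun measurableSet_Ioo h2, lintegral_tsum, ← ENNReal.tsum_mul_left]
  · refine tsum_congr fun p => ?_
    rw [lintegral_mul_const' _ _ ENNReal.ofReal_ne_top, ballWeight, mul_assoc]
  · intro p
    exact (((by fun_prop : Measurable fun r : ℝ => ENNReal.ofReal (r ^ (n - 1))).mul
      (hw.mul (by fun_prop))).mul_const _).aemeasurable

end Parseval

/-! ### Maximum principle for harmonic functions -/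

section MaximumPrinciple

variable {n : ℕ}

/-- With a positive second derivative the point would also be a local minimum, making `g` locally
constant. -/
lemma deriv_deriv_nonpos_of_isLocalMax {g : ℝ → ℝ} {a : ℝ} (hg : ContinuousAt g a)
    (h : IsLocalMax g a) : deriv (deriv g) a ≤ 0 := by
  by_contra! hpos
  have hmin := isLocalMin_of_deriv_deriv_pos hpos h.deriv_eq_zero hg
  have hconst : g =ᶠ[𝓝 a] fun _ => g a := by
    filter_upwards [hmin, h] with t h1 h2 using le_antisymm h2 h1
  have h1 : deriv g =ᶠ[𝓝 a] deriv fun _ => g a := hconst.deriv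
  rw [h1.deriv_eq] at hpos
  simp at hpos

lemma fderiv_fderiv_nonpos_of_isLocalMax {V : Type*} [NormedAddCommGroup V] [NormedSpace ℝ V]
    {w : V → ℝ} {x : V} (hw : ContDiffAt ℝ 2 w x) (h : IsLocalMax w x) (e : V) :
    fderiv ℝ (fderiv ℝ w) x e e ≤ 0 := by
  have hline : ∀ t : ℝ, HasDerivAt (fun t : ℝ => x + t • e) e t := fun t => by
    simpa using ((hasDerivAt_id t).smul_const e).const_add x
  have hcont : Continuous fun t : ℝ => x + t • e := by fun_prop
  have hx0 : x + (0 : ℝ) • e = x := by simp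
  have hev : ∀ᶠ t : ℝ in 𝓝 0, ContDiffAt ℝ 2 w (x + t • e) := by
    have := hcont.tendsto 0
    rw [hx0] at this
    exact this.eventually (hw.eventually (by simp))
  have hd1 : deriv (fun t : ℝ => w (x + t • e)) =ᶠ[𝓝 0] fun t => fderiv ℝ w (x + t • e) e := by
    filter_upwards [hev] with t ht
    exact ((ht.differentiableAt (by norm_num)).hasFDerivAt.comp_hasDerivAt t (hline t)).deriv
  have hd2 : HasDerivAt (fun t : ℝ => fderiv ℝ w (x + t • e) e) (fderiv ℝ (fderiv ℝ w) x e e) 0 := by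
    have h1 : DifferentiableAt ℝ (fderiv ℝ w) (x + (0 : ℝ) • e) := by
      rw [hx0]
      exact (hw.fderiv_right (m := 1) (by norm_num)).differentiableAt (by norm_num)
    have h2 : HasDerivAt (fun t : ℝ => fderiv ℝ w (x + t • e))
        (fderiv ℝ (fderiv ℝ w) (x + (0 : ℝ) • e) e) 0 :=
      h1.hasFDerivAt.comp_hasDerivAt (0 : ℝ) (hline 0)
    rw [hx0] at h2
    simpa using h2.clm_apply (hasDerivAt_const _ e)
  have hmax : IsLocalMax (fun t : ℝ => w (x + t • e)) 0 := by
    have h1 : ∀ᶠ y in 𝓝 (x + (0 : ℝ) • e), w y ≤ w (x + (0 : ℝ) • e) := by rw [hx0]; exact h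
    exact (hcont.tendsto 0).eventually h1
  have hc : ContinuousAt (fun t : ℝ => w (x + t • e)) 0 :=
    ContinuousAt.comp (by rw [hx0]; exact hw.continuousAt) hcont.continuousAt
  have := deriv_deriv_nonpos_of_isLocalMax hc hmax
  rwa [hd1.deriv_eq, hd2.deriv] at this

lemma laplacian_nonpos_of_isLocalMax {w : E n → ℝ} {x : E n} (hw : ContDiffAt ℝ 2 w x)
    (h : IsLocalMax w x) : Laplacian.laplacian w x ≤ 0 := by
  rw [laplacian_eq_iteratedFDeriv_orthonormalBasis w (EuclideanSpace.basisFun (Fin n) ℝ)]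
  refine Finset.sum_nonpos fun k _ => ?_
  rw [iteratedFDeriv_two_apply]
  exact fderiv_fderiv_nonpos_of_isLocalMax hw h _

open MvPolynomial in
lemma lap_sqNorm : lap (sqNorm n) = C (2 * n : ℂ) := by
  classical
  have h : ∀ k : Fin n, pderiv k (sqNorm n) = C 2 * X k := by
    intro k
    simp [sqNorm, pderiv_X, Pi.single_apply, Derivation.leibniz_pow]
    exact (map_ofNat C 2).symm
  simp only [lap, h, pderiv_C_mul, pderiv_X_self]
  simp
  ring

/-- Add `δ|x|²` to a rotated copy of `f`. If the bound failed, the real part would have an interior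
maximum, although its Laplacian is `2nδ > 0`. -/
lemma norm_le_of_norm_le_on_sphere [NeZero n] {f : E n → ℂ} {r ε : ℝ}
    (hf : HarmonicOnNhd f (closedBall 0 r))
    (hε : ∀ x, ‖x‖ = r → ‖f x‖ ≤ ε) {x₀ : E n} (hx₀ : ‖x₀‖ ≤ r) : ‖f x₀‖ ≤ ε := by
  by_contra! hlt
  have hr0 : 0 ≤ r := (norm_nonneg _).trans hx₀
  obtain ⟨c, hc, hcx⟩ : ∃ c : ℂ, ‖c‖ = 1 ∧ (c * f x₀).re = ‖f x₀‖ := by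
    by_cases h0 : f x₀ = 0
    · exact ⟨1, by simp, by simp [h0]⟩
    · refine ⟨starRingEnd ℂ (f x₀) / ‖f x₀‖, by simp [h0], ?_⟩
      have hn0 : ‖f x₀‖ ≠ 0 := norm_ne_zero_iff.2 h0
      rw [div_mul_eq_mul_div, Complex.conj_mul', pow_two, mul_div_assoc, div_self (by exact_mod_cast hn0),
        mul_one, Complex.ofReal_re]
  -- `δ` is so small that the perturbed boundary values stay below the value at `x₀`.
  obtain ⟨δ, hδ0, hδ⟩ : ∃ δ : ℝ, 0 < δ ∧ ε + δ * r ^ 2 < ‖f x₀‖ := by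
    refine ⟨(‖f x₀‖ - ε) / (2 * (r ^ 2 + 1)), div_pos (by linarith) (by positivity), ?_⟩
    have : (‖f x₀‖ - ε) / (2 * (r ^ 2 + 1)) * r ^ 2 < ‖f x₀‖ - ε := by
      rw [div_mul_eq_mul_div, div_lt_iff₀ (by positivity)]
      nlinarith [sq_nonneg r]
    linarith
  set h : E n → ℂ := fun x => c * f x + (δ : ℂ) * ev (sqNorm n) x with hh
  have hre : ∀ x, (h x).re = (c * f x).re + δ * ‖x‖ ^ 2 := by
    intro x
    simp only [hh, ev_sqNorm, Complex.add_re, ← Complex.ofReal_mul, Complex.ofReal_re]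
  have hcd : ∀ x ∈ closedBall (0 : E n) r, ContDiffAt ℝ 2 h x := fun x hx =>
    ((contDiffAt_const.mul (hf x hx).1).add
      (contDiffAt_const.mul (contDiff_ev _).contDiffAt))
  have hcont : ContinuousOn (fun x => (h x).re) (closedBall 0 r) := fun x hx =>
    (Complex.continuous_re.continuousAt.comp (hcd x hx).continuousAt).continuousWithinAt
  obtain ⟨x₁, hx₁, hmax⟩ := (isCompact_closedBall (0 : E n) r).exists_isMaxOn
    ⟨x₀, by simpa using hx₀⟩ hcont
  have h1 : (h x₀).re ≤ (h x₁).re := hmax (by simpa using hx₀)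
  have hx₁r : ‖x₁‖ ≠ r := by
    intro heq
    rw [hre, hre, hcx, heq] at h1
    have h2 : (c * f x₁).re ≤ ε := by
      refine (Complex.re_le_norm _).trans ?_
      rw [norm_mul, hc, one_mul]
      exact hε _ heq
    have : 0 ≤ δ * ‖x₀‖ ^ 2 := by positivity
    linarith
  have hx₁ball : x₁ ∈ ball (0 : E n) r := by
    rw [mem_ball_zero_iff]
    exact lt_of_le_of_ne (by simpa using hx₁) hx₁r
  have hloc : IsLocalMax (Complex.reCLM ∘ h) x₁ := by
    filter_upwards [isOpen_ball.mem_nhds hx₁ball] with y hy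
    exact hmax (ball_subset_closedBall hy)
  have h2 := laplacian_nonpos_of_isLocalMax
    (Complex.reCLM.contDiff.contDiffAt.comp x₁ (hcd x₁ hx₁)) hloc
  have h3 : Laplacian.laplacian h x₁ = (δ : ℂ) * (2 * n) := by
    have e1 : h = c • f + (δ : ℂ) • ev (sqNorm n) := by ext x; simp [hh]
    have e2 : ContDiffAt ℝ 2 (c • f) x₁ := (hf x₁ hx₁).1.const_smul c
    have e3 : ContDiffAt ℝ 2 ((δ : ℂ) • ev (sqNorm n)) x₁ :=
      (contDiff_ev _).contDiffAt.const_smul (δ : ℂ)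
    rw [e1, e2.laplacian_add e3, laplacian_smul _ (hf x₁ hx₁).1,
      laplacian_smul _ (contDiff_ev _).contDiffAt, (hf x₁ hx₁).2.self_of_nhds, laplacian_ev,
      lap_sqNorm, ev_C]
    simp
  rw [(hcd x₁ hx₁).laplacian_CLM_comp_left, Function.comp_apply, h3] at h2
  have h4 : ((δ : ℂ) * (2 * n)) = ((δ * (2 * n) : ℝ) : ℂ) := by push_cast; ring
  rw [h4, Complex.reCLM_apply, Complex.ofReal_re] at h2
  have : (0 : ℝ) < n := by exact_mod_cast Nat.pos_of_ne_zero (NeZero.ne n)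
  have : 0 < δ * (2 * n) := by positivity
  linarith

end MaximumPrinciple

/-! ### The Dirichlet problem with polynomial boundary data -/

section Dirichlet

open MvPolynomial

variable {n : ℕ}

lemma totalDegree_pderiv_le {d : ℕ} (k : Fin n) {P : MvPolynomial (Fin n) ℂ}
    (h : P.totalDegree ≤ d + 1) : (pderiv k P).totalDegree ≤ d := by
  refine Finset.sup_le fun m hm => ?_
  rw [mem_support_iff, coeff_pderiv] at hm
  have h1 : m + Finsupp.single k 1 ∈ P.support := mem_support_iff.2 (left_ne_zero_of_mul hm)
  have h2 := (le_totalDegree h1).trans h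
  rw [Finsupp.sum_add_index' (by simp) (by simp), Finsupp.sum_single_index rfl] at h2
  omega

lemma totalDegree_lap_le {d : ℕ} {P : MvPolynomial (Fin n) ℂ} (h : P.totalDegree ≤ d + 2) :
    (lap P).totalDegree ≤ d :=
  totalDegree_finsetSum_le fun k _ => totalDegree_pderiv_le k (totalDegree_pderiv_le k h)

/-- The polynomial `r² - |x|²`. -/
def sphereEq (n : ℕ) (r : ℝ) : MvPolynomial (Fin n) ℂ := C ((r : ℂ) ^ 2) - sqNorm n

lemma ev_sphereEq {r : ℝ} {x : E n} (hx : ‖x‖ = r) : ev (sphereEq n r) x = 0 := by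
  simp [sphereEq, ev_sqNorm, hx]

lemma sphereEq_ne_zero {r : ℝ} (hr : 0 < r) : sphereEq n r ≠ 0 := by
  intro h
  have := congrArg (fun P => ev P 0) h
  simp [sphereEq, ev_sqNorm, hr.ne'] at this

lemma totalDegree_sphereEq_mul_le {r : ℝ} {d : ℕ} {Q : MvPolynomial (Fin n) ℂ}
    (hQ : Q.totalDegree ≤ d) : (sphereEq n r * Q).totalDegree ≤ d + 2 := by
  have h1 : (sphereEq n r).totalDegree ≤ 2 := by
    refine (totalDegree_sub _ _).trans (max_le ((totalDegree_C _).trans_le zero_le_two) ?_)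
    exact totalDegree_finsetSum_le fun i _ => (totalDegree_pow _ _).trans (by simp)
  exact (totalDegree_mul _ _).trans (by omega)

variable [hn : Fact (2 ≤ n)]

lemma eq_zero_of_lap_eq_zero_of_ev_eq_zero {r : ℝ} (hr : 0 < r) {Q : MvPolynomial (Fin n) ℂ}
    (hQ : lap Q = 0) (h : ∀ x : E n, ‖x‖ = r → ev Q x = 0) : Q = 0 := by
  have h1 : nrm (∑ p ∈ Finset.range (Q.totalDegree + 1), ((r : ℂ) ^ p) • homogeneousComponent p Q) = 0 := by
    rw [nrm_eq_zero_iff]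
    intro ζ
    rw [← sum_ev_real_smul (isSolid_homogeneousComponent hQ), ← ev_sum, sum_homogeneousComponent]
    exact h _ (by simp [norm_smul, abs_of_pos hr])
  rw [nrm_sum_pow_smul (isSolid_homogeneousComponent hQ), Finset.sum_eq_zero_iff_of_nonneg
    fun p _ => mul_nonneg (by positivity) (nrm_nonneg _)] at h1
  rw [← sum_homogeneousComponent Q]
  refine Finset.sum_eq_zero fun p hp => ?_
  exact (isSolid_homogeneousComponent hQ p).eq_zero_of_nrm_eq_zero
    ((mul_eq_zero.1 (h1 p hp)).resolve_left (by positivity))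

/-- Fischer's argument: `Q ↦ Δ((r² - |x|²) Q)` maps polynomials of degree at most `d` to themselves.
It is injective because a harmonic polynomial vanishing on the sphere is zero, hence surjective by
finite dimension; solve for `ΔP` and subtract. -/
lemma exists_harmonic_eq_on_sphere {r : ℝ} (hr : 0 < r) (P : MvPolynomial (Fin n) ℂ) :
    ∃ H : MvPolynomial (Fin n) ℂ, lap H = 0 ∧ ∀ x : E n, ‖x‖ = r → ev H x = ev P x := by
  set d := P.totalDegree
  let T : restrictTotalDegree (Fin n) ℂ d →ₗ[ℂ] restrictTotalDegree (Fin n) ℂ d :=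
    { toFun := fun Q => ⟨lap (sphereEq n r * Q.1), (mem_restrictTotalDegree _ _ _).2
        (totalDegree_lap_le (totalDegree_sphereEq_mul_le ((mem_restrictTotalDegree _ _ _).1 Q.2)))⟩
      map_add' := fun Q R => Subtype.ext (by simp [mul_add, lap_add])
      map_smul' := fun c Q => Subtype.ext (by simp [lap_smul]) }
  have hinj : Function.Injective T := by
    rw [← LinearMap.ker_eq_bot, LinearMap.ker_eq_bot']
    intro Q hQ
    have h1 : lap (sphereEq n r * Q.1) = 0 := congrArg Subtype.val hQ
    have h2 := eq_zero_of_lap_eq_zero_of_ev_eq_zero hr h1 fun x hx => by simp [ev_sphereEq hx]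
    exact Subtype.ext ((mul_eq_zero.1 h2).resolve_left (sphereEq_ne_zero hr))
  obtain ⟨Q, hQ⟩ := LinearMap.injective_iff_surjective.1 hinj
    ⟨lap P, (mem_restrictTotalDegree _ _ _).2 (totalDegree_lap_le (by omega))⟩
  refine ⟨P - sphereEq n r * Q.1, ?_, fun x hx => by simp [ev_sphereEq hx]⟩
  have : lap (sphereEq n r * Q.1) = lap P := congrArg Subtype.val hQ
  rw [lap_sub, this, sub_self]

end Dirichlet

/-! ### Approximation by harmonic polynomials -/

section StoneWeierstrass

open MvPolynomial

variable {n : ℕ}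

lemma exists_ev_near_on_sphere {r ε : ℝ} (hε : 0 < ε) {f : E n → ℂ}
    (hf : ContinuousOn f (sphere 0 r)) :
    ∃ P : MvPolynomial (Fin n) ℂ, ∀ x : E n, ‖x‖ = r → ‖f x - ev P x‖ ≤ ε := by
  let Φ : MvPolynomial (Fin n) ℂ →ₐ[ℂ] C(sphere (0 : E n) r, ℂ) :=
    aeval fun i => ⟨fun x => ((x : E n) i : ℂ), by fun_prop⟩
  have hΦ : ∀ P x, Φ P x = ev P x := by
    intro P x
    induction P using MvPolynomial.induction_on with
    | C a => simp [Φ]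
    | add p q hp hq => simp [hp, hq]
    | mul_X p i hp => simp [hp]; simp [Φ]
  let A : StarSubalgebra ℂ C(sphere (0 : E n) r, ℂ) :=
    { Φ.range with
      star_mem' := by
        rintro _ ⟨P, rfl⟩
        refine ⟨cj P, ?_⟩
        ext x
        change Φ (cj P) x = star (Φ P x)
        rw [hΦ, hΦ, ev_cj]
        rfl }
  have hA : A.SeparatesPoints := by
    intro x y hxy
    obtain ⟨i, hi⟩ : ∃ i, (x : E n) i ≠ (y : E n) i := by
      by_contra! h
      exact hxy (Subtype.ext (PiLp.ext h))
    refine ⟨_, ⟨Φ (X i), ⟨X i, rfl⟩, rfl⟩, ?_⟩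
    simpa [hΦ] using hi
  have htop := ContinuousMap.starSubalgebra_topologicalClosure_eq_top_of_separatesPoints A hA
  let g : C(sphere (0 : E n) r, ℂ) := ⟨fun x => f x, continuousOn_iff_continuous_domRestrict.1 hf⟩
  have hg : g ∈ closure (A : Set C(sphere (0 : E n) r, ℂ)) := by
    rw [← StarSubalgebra.topologicalClosure_coe, htop]
    trivial
  obtain ⟨_, ⟨P, rfl⟩, hP⟩ := Metric.mem_closure_iff.1 hg ε hε
  refine ⟨P, fun x hx => ?_⟩
  have h1 := ContinuousMap.dist_apply_le_dist (f := g) (g := Φ P) ⟨x, by simpa using hx⟩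
  have h2 := h1.trans hP.le
  rw [dist_eq_norm, hΦ] at h2
  exact h2

variable [hn : Fact (2 ≤ n)]

/-- Approximate `f` on the sphere by a polynomial, replace that by its harmonic counterpart, and
carry the error inside by the maximum principle. -/
lemma exists_harmonic_near {f : E n → ℂ} (hf : HarmonicOnNhd f (ball 0 1)) {r ε : ℝ} (hr0 : 0 < r)
    (hr1 : r < 1) (hε : 0 < ε) : ∃ H : MvPolynomial (Fin n) ℂ, lap H = 0 ∧
      ∀ x : E n, ‖x‖ ≤ r → ‖f x - ev H x‖ ≤ ε := by
  have : NeZero n := ⟨by have := hn.out; omega⟩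
  have hsub : closedBall (0 : E n) r ⊆ ball 0 1 := closedBall_subset_ball hr1
  obtain ⟨P, hP⟩ := exists_ev_near_on_sphere hε
    (hf.continuousOn.mono (sphere_subset_closedBall.trans hsub))
  obtain ⟨H, hH, hHP⟩ := exists_harmonic_eq_on_sphere hr0 P
  refine ⟨H, hH, fun x hx => ?_⟩
  have hh : HarmonicOnNhd (f - ev H) (closedBall 0 r) := (hf.mono hsub).sub
    (((harmonicOnNhd_ev_iff H).2 hH).mono (Set.subset_univ _))
  exact norm_le_of_norm_le_on_sphere hh (fun y hy => by
    simpa [hHP y hy] using hP y hy) hx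

end StoneWeierstrass

/-! ### Existence of the expansion -/

section Existence

open MvPolynomial

variable {n : ℕ}

/-- The functions given by solid harmonics of degree `p`. -/
def solidFun (n p : ℕ) : Submodule ℂ (E n → ℂ) where
  carrier := {g | IsSolidHarmonic n p g}
  zero_mem' := isSolidHarmonic_iff.2 ⟨0, ⟨isHomogeneous_zero _ _ _, by simp [lap]⟩, by ext; simp⟩
  add_mem' := by
    intro f g hf hg
    obtain ⟨P, hP, rfl⟩ := isSolidHarmonic_iff.1 hf
    obtain ⟨Q, hQ, rfl⟩ := isSolidHarmonic_iff.1 hg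
    exact isSolidHarmonic_iff.2 ⟨P + Q, hP.add hQ, by ext; simp⟩
  smul_mem' := by
    intro c f hf
    obtain ⟨P, hP, rfl⟩ := isSolidHarmonic_iff.1 hf
    exact isSolidHarmonic_iff.2 ⟨c • P, hP.smul c, by ext; simp⟩

/-- Evaluation of polynomials as a linear map. -/
def evₗ (n : ℕ) : MvPolynomial (Fin n) ℂ →ₗ[ℂ] (E n → ℂ) where
  toFun := ev
  map_add' P Q := by ext; simp
  map_smul' c P := by ext; simp

/-- Finite-dimensional subspaces are closed even for pointwise convergence, so pointwise limits of
solid harmonics of degree `p` are again such. -/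
lemma isClosed_solidFun (n p : ℕ) : IsClosed (solidFun n p : Set (E n → ℂ)) := by
  have h : solidFun n p ≤ (restrictTotalDegree (Fin n) ℂ p).map (evₗ n) := by
    intro g hg
    obtain ⟨P, hP, rfl⟩ := isSolidHarmonic_iff.1 hg
    exact ⟨P, (mem_restrictTotalDegree _ _ _).2 hP.1.totalDegree_le, rfl⟩
  have : FiniteDimensional ℂ (solidFun n p) := Submodule.finiteDimensional_of_le h
  exact Submodule.closed_of_finiteDimensional _

lemma homogeneousComponent_eq_zero_of_notMem_range {Q : MvPolynomial (Fin n) ℂ} {N p : ℕ}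
    (hN : Q.totalDegree + 1 ≤ N) : p ∉ Finset.range N → homogeneousComponent p Q = 0 := fun hp =>
  homogeneousComponent_eq_zero _ _ (by simp only [Finset.mem_range] at hp; omega)

lemma sum_homogeneousComponent_of_le {Q : MvPolynomial (Fin n) ℂ} {N : ℕ}
    (hN : Q.totalDegree + 1 ≤ N) : ∑ p ∈ Finset.range N, homogeneousComponent p Q = Q := by
  conv_rhs => rw [← sum_homogeneousComponent Q]
  symm
  refine Finset.sum_subset (Finset.range_mono hN) fun p _ hp => ?_
  exact homogeneousComponent_eq_zero_of_notMem_range le_rfl hp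

variable [hn : Fact (2 ≤ n)]

/-- A Cauchy estimate whose constants do not depend on `Q` or `p`: it controls limits of components
and the tails of their sums alike. -/
lemma exists_norm_component_le {r : ℝ} (hr0 : 0 ≤ r) (hr : r < 1) :
    ∃ R : ℝ, 0 < R ∧ R < 1 ∧ r ≤ R ∧ ∃ θ : ℝ, 0 ≤ θ ∧ θ < 1 ∧ ∃ K : ℝ, 0 ≤ K ∧
      ∀ Q : MvPolynomial (Fin n) ℂ, lap Q = 0 → ∀ M : ℝ, (∀ y : E n, ‖y‖ ≤ R → ‖ev Q y‖ ≤ M) →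
        ∀ (p : ℕ) (x : E n), ‖x‖ ≤ r → ‖ev (homogeneousComponent p Q) x‖ ≤ K * (θ ^ p * M) := by
  obtain ⟨s, hs0, hs1, K, hK, hb⟩ := exists_norm_ev_le (n := n) hr0 hr
  -- `R > s` makes the ratio `θ = s / R` less than 1; `R > r` keeps the small ball inside.
  obtain ⟨R, hsR, hR1⟩ := exists_between (max_lt hs1 hr)
  have hsR' := (le_max_left _ _).trans_lt hsR
  have hR0 := hs0.trans hsR'
  refine ⟨R, hR0, hR1, ((le_max_right _ _).trans_lt hsR).le, s / R, by positivity,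
    (div_lt_one hR0).2 hsR', K, hK, fun Q hQ M hM p x hx => ?_⟩
  have hM0 : 0 ≤ M := (norm_nonneg _).trans (hM 0 (by simpa using hR0.le))
  have hsol := isSolid_homogeneousComponent hQ
  have h1 : nrm (∑ q ∈ Finset.range (max (Q.totalDegree + 1) (p + 1)),
      ((R : ℂ) ^ q) • homogeneousComponent q Q) ≤ M ^ 2 := by
    refine nrm_le_of_forall_norm_le fun ζ => ?_
    rw [← sum_ev_real_smul hsol, ← ev_sum, sum_homogeneousComponent_of_le (le_max_left _ _)]
    exact hM _ (by simp [norm_smul, abs_of_pos hR0])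
  rw [nrm_sum_pow_smul hsol] at h1
  have h2 : R ^ (2 * p) * nrm (homogeneousComponent p Q) ≤ M ^ 2 := (Finset.single_le_sum
    (f := fun q => R ^ (2 * q) * nrm (homogeneousComponent q Q))
    (fun q _ => by have := nrm_nonneg (homogeneousComponent q Q); positivity)
    (Finset.mem_range.2 (lt_of_lt_of_le (Nat.lt_succ_self p) (le_max_right _ _)))).trans h1
  have h3 : R ^ p * √(nrm (homogeneousComponent p Q)) ≤ M := by
    refine le_of_sq_le_sq ?_ hM0
    rw [mul_pow, Real.sq_sqrt (nrm_nonneg _), ← pow_mul, mul_comm p 2]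
    exact h2
  refine (hb p _ (hsol p) x hx).trans ?_
  gcongr K * ?_
  calc s ^ p * √(nrm (homogeneousComponent p Q)) =
        (s / R) ^ p * (R ^ p * √(nrm (homogeneousComponent p Q))) := by
        rw [← mul_assoc, ← mul_pow, div_mul_cancel₀ _ hR0.ne']
    _ ≤ _ := by gcongr

lemma exists_harmonic_tendsto {f : E n → ℂ} (hf : HarmonicOnNhd f (ball 0 1)) :
    ∃ H : ℕ → MvPolynomial (Fin n) ℂ, (∀ k, lap (H k) = 0) ∧
      ∀ r < 1, TendstoUniformlyOn (fun k => ev (H k)) f atTop (closedBall 0 r) := by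
  have hpos : ∀ k : ℕ, (0 : ℝ) < 1 / ((k : ℝ) + 2) := fun k => by positivity
  have hlt : ∀ k : ℕ, 1 / ((k : ℝ) + 2) < 1 := fun k => by
    rw [div_lt_one (by positivity)]
    linarith [(Nat.cast_nonneg k : (0 : ℝ) ≤ k)]
  choose H hH hfH using fun k : ℕ => exists_harmonic_near hf (r := 1 - 1 / ((k : ℝ) + 2))
    (ε := 1 / ((k : ℝ) + 2)) (by linarith [hlt k]) (by linarith [hpos k]) (hpos k)
  have hlim : Tendsto (fun k : ℕ => 1 / ((k : ℝ) + 2)) atTop (𝓝 0) :=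
    tendsto_const_nhds.div_atTop (tendsto_atTop_add_const_right _ _ tendsto_natCast_atTop_atTop)
  refine ⟨H, hH, fun r hr => Metric.tendstoUniformlyOn_iff.2 fun ε hε => ?_⟩
  filter_upwards [hlim.eventually (gt_mem_nhds hε), hlim.eventually (gt_mem_nhds (sub_pos.2 hr))]
    with k h1 h2 x hx
  rw [dist_eq_norm]
  exact (hfH k x (by rw [mem_closedBall_zero_iff] at hx; linarith)).trans_lt h1

lemma exists_isHarmonicExpansion {f : E n → ℂ} (hf : HarmonicOnNhd f (ball 0 1)) :
    ∃ F, IsHarmonicExpansion n f F := by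
  obtain ⟨H, hH, hlim⟩ := exists_harmonic_tendsto hf
  have hsub : ∀ k l, lap (H k - H l) = 0 := fun k l => by rw [lap_sub, hH, hH, sub_self]
  -- The radius 1/2 is arbitrary: homogeneity carries convergence from this ball to all of space in
  -- the next step.
  have hball : ∀ (p : ℕ) (x : E n), ‖x‖ ≤ 1 / 2 →
      CauchySeq fun k => ev (homogeneousComponent p (H k)) x := by
    intro p x hx
    obtain ⟨R, hR0, hR1, hrR, θ, hθ0, hθ1, K, hK, hb⟩ :=
      exists_norm_component_le (n := n) (r := 1 / 2) (by norm_num) (by norm_num)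
    rw [Metric.cauchySeq_iff]
    intro ε hε
    have hη : 0 < ε / (K + 1) / 2 := by positivity
    obtain ⟨N, hN⟩ := eventually_atTop.1 (Metric.tendstoUniformlyOn_iff.1 (hlim R hR1) _ hη)
    refine ⟨N, fun k hk l hl => ?_⟩
    rw [dist_eq_norm, ← ev_sub, ← map_sub]
    have h1 := hb _ (hsub k l) (ε / (K + 1)) (fun y hy => by
      have h2 := hN k hk y (by simpa using hy)
      have h3 := hN l hl y (by simpa using hy)
      rw [ev_sub, ← dist_eq_norm]
      rw [dist_comm] at h2
      linarith [dist_triangle (ev (H k) y) (f y) (ev (H l) y)]) p x hx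
    refine h1.trans_lt ?_
    calc K * (θ ^ p * (ε / (K + 1))) ≤ K * (1 * (ε / (K + 1))) := by
          gcongr
          exact pow_le_one₀ hθ0 hθ1.le
      _ < ε := by
          rw [one_mul, ← mul_div_assoc, div_lt_iff₀ (by positivity)]
          nlinarith
  have hex : ∀ (p : ℕ) (x : E n), ∃ z,
      Tendsto (fun k => ev (homogeneousComponent p (H k)) x) atTop (𝓝 z) := by
    intro p x
    set t : ℝ := 2 * (‖x‖ + 1) with ht
    have ht0 : 0 < t := by positivity
    obtain ⟨z, hz⟩ := cauchySeq_tendsto_of_complete (hball p (t⁻¹ • x) (by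
      rw [norm_smul, Real.norm_of_nonneg (by positivity), inv_mul_le_iff₀ ht0, ht]
      linarith [norm_nonneg x]))
    refine ⟨(t : ℂ) ^ p * z, ?_⟩
    have h1 : ∀ k, ev (homogeneousComponent p (H k)) x =
        (t : ℂ) ^ p * ev (homogeneousComponent p (H k)) (t⁻¹ • x) := by
      intro k
      rw [← ev_real_smul (homogeneousComponent_isHomogeneous _ _), smul_smul,
        mul_inv_cancel₀ ht0.ne', one_smul]
    simp only [h1]
    exact hz.const_mul _
  choose F hF using hex
  refine ⟨F, fun p => ?_, tendstoLocallyUniformlyOn_ball_iff.2 fun r hr => ?_⟩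
  · have h1 : Tendsto (fun k => ev (homogeneousComponent p (H k))) atTop (𝓝 (F p)) :=
      tendsto_pi_nhds.2 (hF p)
    exact (isClosed_solidFun n p).mem_of_tendsto h1 (Eventually.of_forall fun k =>
      isSolidHarmonic_iff.2 ⟨_, isSolid_homogeneousComponent (hH k) p, rfl⟩)
  · rcases lt_or_ge r 0 with h | h
    · rw [closedBall_eq_empty.2 h]
      exact tendstoUniformlyOn_empty
    obtain ⟨R, hR0, hR1, hrR, θ, hθ0, hθ1, K, hK, hb⟩ := exists_norm_component_le (n := n) h hr
    obtain ⟨B, hB⟩ := (isCompact_closedBall (0 : E n) R).exists_bound_of_continuousOn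
      (hf.continuousOn.mono (closedBall_subset_ball hR1))
    have hB0 : 0 ≤ B := (norm_nonneg _).trans (hB 0 (by simp [hR0.le]))
    -- The tail beyond degree `N` of each approximant is bounded by a geometric tail independent of
    -- `k`, so the bound survives `k → ∞`.
    have hkey : ∀ (N : ℕ) (x : E n), ‖x‖ ≤ r →
        ‖f x - ∑ p ∈ Finset.range N, F p x‖ ≤ K * (B + 1) * (θ ^ N / (1 - θ)) := by
      intro N x hx
      have hfx : Tendsto (fun k => ev (H k) x) atTop (𝓝 (f x)) :=
        (hlim r hr).tendsto_at (by simpa using hx)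
      have hlim2 := (hfx.sub (tendsto_finsetSum (Finset.range N) fun p _ => hF p x)).norm
      refine le_of_tendsto hlim2 ?_
      filter_upwards [Metric.tendstoUniformlyOn_iff.1 (hlim R hR1) 1 one_pos] with k hk
      have hbk := hb _ (hH k) (B + 1) fun y hy => by
        have h1 := hk y (by simpa using hy)
        have h2 := hB y (by simpa using hy)
        rw [dist_eq_norm, norm_sub_rev] at h1
        have := norm_le_norm_add_norm_sub' (ev (H k) y) (f y)
        linarith
      -- Beyond the total degree the components vanish, so the sum up to `D` is all of `H k`, while
      -- `D ≥ N` lets the first `N` terms be subtracted.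
      set D := max N ((H k).totalDegree + 1) with hD
      have h1 : ev (H k) x = ∑ p ∈ Finset.range D, ev (homogeneousComponent p (H k)) x := by
        rw [← ev_sum, sum_homogeneousComponent_of_le (le_max_right _ _)]
      rw [h1, ← Finset.sum_Ico_eq_sub _ (le_max_left _ _)]
      calc _ ≤ ∑ p ∈ Finset.Ico N D, K * (θ ^ p * (B + 1)) :=
            norm_sum_le_of_le _ fun p _ => hbk p x hx
        _ = K * (B + 1) * ∑ p ∈ Finset.Ico N D, θ ^ p := by
            rw [Finset.mul_sum]
            exact Finset.sum_congr rfl fun p _ => by ring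
        _ ≤ _ := by
            gcongr
            exact geom_sum_Ico_le_of_lt_one hθ0 hθ1
    have hz : Tendsto (fun N : ℕ => K * (B + 1) * (θ ^ N / (1 - θ))) atTop (𝓝 0) := by
      simpa using ((tendsto_pow_atTop_nhds_zero_of_lt_one hθ0 hθ1).div_const (1 - θ)).const_mul
        (K * (B + 1))
    refine Metric.tendstoUniformlyOn_iff.2 fun ε hε => ?_
    filter_upwards [hz.eventually (gt_mem_nhds hε)] with N hN x hx
    rw [dist_eq_norm]
    exact (hkey N x (by simpa using hx)).trans_lt hN

lemma isHarmonicExpansion_component {f : E n → ℂ} (hf : HarmonicOnNhd f (ball 0 1)) :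
    IsHarmonicExpansion n f (component n f) :=
  Classical.epsilon_spec (exists_isHarmonicExpansion hf)

end Existence

/-! ### The weights of the tangential form and their comparison -/

section Weights

open MvPolynomial

/-- This is the statement that the Beta distribution has total mass one. -/
lemma lintegral_beta {a b : ℝ} (ha : 0 < a) (hb : 0 < b) :
    ∫⁻ x in Set.Ioo (0 : ℝ) 1, ENNReal.ofReal (x ^ (a - 1) * (1 - x) ^ (b - 1)) =
      ENNReal.ofReal (ProbabilityTheory.beta a b) := by
  have h := ProbabilityTheory.lintegral_betaPDF_eq_one ha hb
  have hpos := ProbabilityTheory.beta_pos ha hb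
  rw [ProbabilityTheory.lintegral_betaPDF] at h
  simp only [mul_assoc, ENNReal.ofReal_mul (one_div_pos.2 hpos).le] at h
  rw [lintegral_const_mul' _ _ ENNReal.ofReal_ne_top] at h
  generalize ∫⁻ x in Set.Ioo (0 : ℝ) 1, ENNReal.ofReal (x ^ (a - 1) * (1 - x) ^ (b - 1)) = I at h ⊢
  rw [← one_mul I, ← ENNReal.ofReal_one, ← mul_one_div_cancel hpos.ne', ENNReal.ofReal_mul hpos.le,
    mul_assoc, h, mul_one]

/-- Substitute `x = r²` in the Beta integral. -/
lemma lintegral_radial {a b : ℝ} (ha : 0 < a) (hb : 0 < b) :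
    ∫⁻ r in Set.Ioo (0 : ℝ) 1, ENNReal.ofReal (r ^ (2 * a - 1) * (1 - r ^ 2) ^ (b - 1)) =
      ENNReal.ofReal (ProbabilityTheory.beta a b / 2) := by
  have himg : (fun r : ℝ => r ^ 2) '' Set.Ioo 0 1 = Set.Ioo 0 1 := by
    ext y
    constructor
    · rintro ⟨x, ⟨hx0, hx1⟩, rfl⟩
      exact ⟨by positivity, pow_lt_one₀ hx0.le hx1 two_ne_zero⟩
    · rintro ⟨hy0, hy1⟩
      exact ⟨√y, ⟨Real.sqrt_pos.2 hy0, by rw [Real.sqrt_lt' one_pos]; simpa using hy1⟩,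
        Real.sq_sqrt hy0.le⟩
  have h := lintegral_image_eq_lintegral_abs_deriv_mul (s := Set.Ioo (0 : ℝ) 1)
    (f := fun r => r ^ 2) (f' := fun r => 2 * r) measurableSet_Ioo
    (fun x _ => by simpa using (hasDerivAt_pow 2 x).hasDerivWithinAt)
    (fun x hx y hy hxy => (sq_eq_sq₀ hx.1.le hy.1.le).1 hxy)
    (fun x => ENNReal.ofReal (x ^ (a - 1) * (1 - x) ^ (b - 1)))
  rw [himg, lintegral_beta ha hb] at h
  have h2 : ∀ r ∈ Set.Ioo (0 : ℝ) 1, ENNReal.ofReal |2 * r| *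
      ENNReal.ofReal ((r ^ 2) ^ (a - 1) * (1 - r ^ 2) ^ (b - 1)) =
      ENNReal.ofReal 2 * ENNReal.ofReal (r ^ (2 * a - 1) * (1 - r ^ 2) ^ (b - 1)) := by
    rintro r ⟨hr0, hr1⟩
    rw [← ENNReal.ofReal_mul (abs_nonneg _), ← ENNReal.ofReal_mul zero_le_two,
      abs_of_pos (by positivity)]
    congr 1
    have : r ^ (2 * a - 1) = r * (r ^ 2) ^ (a - 1) := by
      rw [← Real.rpow_natCast r 2, ← Real.rpow_mul hr0.le]
      conv_rhs => rw [← Real.rpow_one r, ← Real.rpow_mul hr0.le, one_mul, ← Real.rpow_add hr0]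
      congr 1
      push_cast
      ring
    rw [this]
    ring
  rw [setLIntegral_congr_fun measurableSet_Ioo h2, lintegral_const_mul' _ _ ENNReal.ofReal_ne_top] at h
  rw [ENNReal.ofReal_div_of_pos two_pos, h, mul_comm (ENNReal.ofReal 2), ENNReal.mul_div_cancel_right]
  · simp
  · simp

lemma Gamma_add_natCast {a : ℝ} (ha : 0 < a) (p : ℕ) :
    Real.Gamma (p + a) = (ascPochhammer ℝ p).eval a * Real.Gamma a := by
  induction p with
  | zero => simp
  | succ p ih =>
    rw [ascPochhammer_succ_eval, Nat.cast_succ, add_right_comm, Real.Gamma_add_one (by positivity),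
      ih]
    ring

lemma ascPochhammer_eval_nonneg {a : ℝ} (ha : 0 < a) (p : ℕ) :
    0 ≤ (ascPochhammer ℝ p).eval a := (ascPochhammer_pos p a ha).le

/-- Each of the `k` extra factors `p + 1, …, p + k` lies between `p` and `(k + 1)p`. -/
lemma factorial_add_bounds (p k : ℕ) (hp : 1 ≤ p) :
    p ^ k * p ! ≤ (p + k)! ∧ (p + k)! ≤ ((k + 1) * p) ^ k * p ! := by
  rw [← Nat.factorial_mul_ascFactorial]
  constructor
  · rw [mul_comm]
    refine Nat.mul_le_mul_left _ ?_
    exact (Nat.pow_le_pow_left (Nat.le_succ p) k).trans (Nat.pow_succ_le_ascFactorial (p + 1) k)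
  · rw [mul_comm]
    refine Nat.mul_le_mul_right _ ((Nat.ascFactorial_le_pow_add p k).trans
      (Nat.pow_le_pow_left ?_ k))
    nlinarith

variable {n : ℕ} [hn : Fact (2 ≤ n)]

lemma sum_nrm_rotList {p : ℕ} {P : MvPolynomial (Fin n) ℂ} (hP : IsSolid p P) (m : ℕ) :
    ∑ J : Fin m → PairIndex n, nrm (rotList (List.ofFn J) P) =
      (2 * (p * (p + n - 2)) : ℝ) ^ m * nrm P := by
  have hsol : ∀ l : List (PairIndex n), IsSolid p (rotList l P) := by
    intro l
    induction l with
    | nil => exact hP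
    | cons a l ih => exact ih.isSolid_rot _ _
  induction m with
  | zero => simp [rotList]
  | succ m ih =>
    -- The head of the tuple is the outermost field; summing over it yields one eigenvalue factor.
    rw [← (Fin.consEquiv fun _ => PairIndex n).sum_comp, Fintype.sum_prod_type_right]
    have h : ∀ (a : PairIndex n) (J : Fin m → PairIndex n),
        rotList (List.ofFn (Fin.consEquiv (fun _ => PairIndex n) (a, J))) P =
          rot a.1.1 a.1.2 (rotList (List.ofFn J) P) := by
      intro a J
      simp [Fin.consEquiv, List.ofFn_succ, rotList]
    simp only [h, (hsol _).sum_pairIndex_nrm_rot]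
    rw [← Finset.mul_sum, ih]
    ring

/-- The ratio of the squared tangential seminorm and the squared norm on the sphere of a solid
harmonic of degree `p`. -/
def tangentialWeight (n m p : ℕ) : ℝ≥0∞ :=
  ENNReal.ofReal ((2 * (p * (p + n - 2)) : ℝ) ^ m) *
    ballWeight n (2 * (m : ℝ) - (n : ℝ) / 2 - 1) p

/-- The tangential form is diagonal: fields act on each component separately, and Parseval on the
ball removes cross terms. -/
lemma tangentialNormSq_eq_tsum {f : E n → ℂ} (hf : HarmonicOnNhd f (ball 0 1)) (m : ℕ) :
    tangentialNormSq n m f = ∑' p, tangentialWeight n m p * sphereNormSq n (component n f p) := by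
  obtain ⟨P, hP, hFP, hfP⟩ := (isHarmonicExpansion_component hf).exists_isGood
  have hJ : ∀ J : Fin m → PairIndex n,
      ballNormSq n (2 * (m : ℝ) - (n : ℝ) / 2 - 1) (iteratedTangential n m J f) =
      ∑' p, ballWeight n (2 * (m : ℝ) - (n : ℝ) / 2 - 1) p *
        ENNReal.ofReal (nrm (rotList (List.ofFn J) (P p))) := fun J =>
    (hP.rotList (List.ofFn J)).ballNormSq (hP.eqOn_foldr_tangential hfP (List.ofFn J)) _
  simp only [tangentialNormSq, hJ]
  rw [← Summable.tsum_finsetSum fun _ _ => ENNReal.summable]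
  refine tsum_congr fun p => ?_
  rw [← Finset.mul_sum, ← ENNReal.ofReal_sum_of_nonneg fun _ _ => nrm_nonneg _,
    sum_nrm_rotList (hP.solid p), hFP, sphereNormSq_ev, tangentialWeight,
    ENNReal.ofReal_mul' (nrm_nonneg _)]
  ring

/-- The radial integral is half of the Beta value at `(p + n/2, 2m - n/2)`; all factors independent
of `p` go into `κ`. -/
lemma exists_ballWeight_eq {m : ℕ} (hm : (n : ℝ) / 4 < m) : ∃ κ : ℝ, 0 < κ ∧ ∀ p : ℕ,
    ballWeight n (2 * (m : ℝ) - (n : ℝ) / 2 - 1) p =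
      ENNReal.ofReal (κ * ((ascPochhammer ℝ p).eval ((n : ℝ) / 2) / ((p + (2 * m - 1))! : ℕ))) := by
  have hn0 : (2 : ℝ) ≤ n := by exact_mod_cast hn.out
  have hm1 : 1 ≤ m := by
    by_contra h
    have : m = 0 := by omega
    subst this
    simp at hm
    linarith
  set b : ℝ := 2 * (m : ℝ) - (n : ℝ) / 2 with hb
  have hb0 : 0 < b := by rw [hb]; linarith
  have hn2 : (0 : ℝ) < (n : ℝ) / 2 := by linarith
  set A : ℝ := Real.Gamma ((n : ℝ) / 2 + (b - 1) + 1) /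
      (Real.pi ^ ((n : ℝ) / 2) * Real.Gamma (b - 1 + 1)) with hA
  have hA0 : 0 < A := div_pos (Real.Gamma_pos_of_pos (by linarith))
    (mul_pos (Real.rpow_pos_of_pos Real.pi_pos _) (Real.Gamma_pos_of_pos (by linarith)))
  have hS0 : 0 < (surf n).toReal := ENNReal.toReal_pos surf_ne_zero surf_ne_top
  have hG1 := Real.Gamma_pos_of_pos hb0
  have hG2 := Real.Gamma_pos_of_pos hn2
  refine ⟨(surf n).toReal * A * (Real.Gamma ((n : ℝ) / 2) * Real.Gamma b / 2), by positivity,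
    fun p => ?_⟩
  have hpa : (0 : ℝ) < p + (n : ℝ) / 2 := by positivity
  have h1 : ∀ r ∈ Set.Ioo (0 : ℝ) 1, ENNReal.ofReal (r ^ (n - 1)) *
      (radialWeight n (b - 1) r * ENNReal.ofReal (r ^ (2 * p))) = ENNReal.ofReal A *
      ENNReal.ofReal (r ^ (2 * (p + (n : ℝ) / 2) - 1) * (1 - r ^ 2) ^ (b - 1)) := by
    rintro r ⟨hr0, hr1⟩
    have hr2 : 0 ≤ 1 - r ^ 2 := by nlinarith
    have hr3 : 0 ≤ (1 - r ^ 2) ^ (b - 1) := Real.rpow_nonneg hr2 _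
    rw [radialWeight, ← hA, ← ENNReal.ofReal_mul (by positivity), ← ENNReal.ofReal_mul (by positivity),
      ← ENNReal.ofReal_mul (by positivity)]
    congr 1
    have : r ^ (2 * (p + (n : ℝ) / 2) - 1) = r ^ (n - 1) * r ^ (2 * p) := by
      rw [← pow_add, ← Real.rpow_natCast]
      congr 1
      rw [Nat.cast_add, Nat.cast_sub (by have := hn.out; omega)]
      push_cast
      ring
    rw [this]
    ring
  rw [ballWeight, setLIntegral_congr_fun measurableSet_Ioo h1,
    lintegral_const_mul' _ _ ENNReal.ofReal_ne_top, lintegral_radial hpa hb0,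
    ← ENNReal.ofReal_toReal (surf_ne_top (n := n)), ← ENNReal.ofReal_mul hA0.le,
    ← ENNReal.ofReal_mul hS0.le, ENNReal.toReal_ofReal hS0.le]
  congr 1
  -- The exponent is chosen for this: the two halves of `n` cancel and the Gamma function becomes a
  -- factorial.
  have h2 : (p : ℝ) + (n : ℝ) / 2 + b = ((p + (2 * m - 1) : ℕ) : ℝ) + 1 := by
    rw [Nat.cast_add, Nat.cast_sub (by omega), hb]
    push_cast
    ring
  rw [ProbabilityTheory.beta, h2, Real.Gamma_nat_eq_factorial, Gamma_add_natCast hn2]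
  ring

/-- For `p ≥ 1`, `p(p + n - 2)` lies between `p²` and `n p²`, and `(p + 2m - 1)!` is comparable to
`p^(2m-1) p!`; one factor `p` survives. For `p = 0` everything vanishes because `m ≥ 1`. -/
lemma symbol_bounds {m : ℕ} (hm : 1 ≤ m) (p : ℕ) :
    (p : ℝ) / p ! ≤ (2 * m : ℝ) ^ (2 * m - 1) * ((p * (p + n - 2) : ℝ) ^ m / (p + (2 * m - 1))!) ∧
    (p * (p + n - 2) : ℝ) ^ m / (p + (2 * m - 1))! ≤ (n : ℝ) ^ m * (p / p !) := by
  have hn0 : (2 : ℝ) ≤ n := by exact_mod_cast hn.out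
  rcases Nat.eq_zero_or_pos p with rfl | hp
  · have : m ≠ 0 := by omega
    simp [this]
  obtain ⟨k, hk⟩ : ∃ k, 2 * m = k + 1 := ⟨2 * m - 1, by omega⟩
  have hk' : 2 * m - 1 = k := by omega
  have hkR : (2 * m : ℝ) = k + 1 := by exact_mod_cast hk
  obtain ⟨h1, h2⟩ := factorial_add_bounds p k hp
  have h1' : (p : ℝ) ^ k * p ! ≤ (p + k)! := by exact_mod_cast h1
  have h2' : ((p + k)! : ℝ) ≤ ((k + 1) * p) ^ k * p ! := by exact_mod_cast h2
  have hp1 : (1 : ℝ) ≤ p := by exact_mod_cast hp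
  have hp0 : (0 : ℝ) < p := by linarith
  have hf : (0 : ℝ) < p ! := by exact_mod_cast Nat.factorial_pos p
  have hf2 : (0 : ℝ) < (p + k)! := by exact_mod_cast Nat.factorial_pos _
  have hpp : (p : ℝ) ^ (2 * m) = p * (p : ℝ) ^ k := by rw [hk, pow_succ, mul_comm]
  have l1 : (p : ℝ) ^ (2 * m) ≤ (p * (p + n - 2) : ℝ) ^ m := by
    rw [pow_mul]
    gcongr
    nlinarith
  have l2 : (p * (p + n - 2) : ℝ) ^ m ≤ (n : ℝ) ^ m * (p : ℝ) ^ (2 * m) := by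
    rw [pow_mul, ← mul_pow]
    refine pow_le_pow_left₀ (mul_nonneg hp0.le (by linarith)) ?_ m
    have : (p + n - 2 : ℝ) ≤ n * p := by nlinarith [mul_nonneg (sub_nonneg.2 hp1) (sub_nonneg.2 hn0)]
    nlinarith
  rw [hk', hkR]
  constructor
  · rw [← mul_div_assoc, div_le_div_iff₀ hf hf2]
    calc (p : ℝ) * (p + k)! ≤ p * (((k + 1) * p) ^ k * p !) := by gcongr
      _ = (k + 1 : ℝ) ^ k * (p : ℝ) ^ (2 * m) * p ! := by rw [hpp, mul_pow]; ring
      _ ≤ _ := by gcongr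
  · rw [← mul_div_assoc, div_le_div_iff₀ hf2 hf]
    calc (p * (p + n - 2) : ℝ) ^ m * p ! ≤ (n : ℝ) ^ m * (p : ℝ) ^ (2 * m) * p ! := by gcongr
      _ = (n : ℝ) ^ m * p * ((p : ℝ) ^ k * p !) := by rw [hpp]; ring
      _ ≤ _ := by gcongr

lemma exists_tangentialWeight_bounds {m : ℕ} (hm : (n : ℝ) / 4 < m) : ∃ c C : ℝ, 0 < c ∧ 0 < C ∧
    ∀ p : ℕ, ENNReal.ofReal c * ENNReal.ofReal (dirichletCoeff n p) ≤ tangentialWeight n m p ∧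
      tangentialWeight n m p ≤ ENNReal.ofReal C * ENNReal.ofReal (dirichletCoeff n p) := by
  have hn0 : (2 : ℝ) ≤ n := by exact_mod_cast hn.out
  have hm1 : 1 ≤ m := by
    by_contra h
    have : m = 0 := by omega
    subst this
    simp at hm
    linarith
  have hm0 : (0 : ℝ) < m := by exact_mod_cast hm1
  obtain ⟨κ, hκ, hw⟩ := exists_ballWeight_eq hm
  refine ⟨κ * 2 ^ m / (2 * m : ℝ) ^ (2 * m - 1), κ * 2 ^ m * (n : ℝ) ^ m, by positivity,
    by positivity, fun p => ?_⟩
  set D := (ascPochhammer ℝ p).eval ((n : ℝ) / 2) with hD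
  have hD0 : 0 ≤ D := ascPochhammer_eval_nonneg (by linarith) p
  obtain ⟨h1, h2⟩ := symbol_bounds (n := n) hm1 p
  have hX : (0 : ℝ) ≤ p * (p + n - 2) := mul_nonneg (Nat.cast_nonneg p)
    (by linarith [(Nat.cast_nonneg p : (0 : ℝ) ≤ p)])
  have htw : tangentialWeight n m p = ENNReal.ofReal (κ * 2 ^ m * D *
      ((p * (p + n - 2) : ℝ) ^ m / (p + (2 * m - 1))!)) := by
    rw [tangentialWeight, hw, ← ENNReal.ofReal_mul (by positivity), mul_pow]
    congr 1
    ring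
  rw [htw, ← ENNReal.ofReal_mul (by positivity), ← ENNReal.ofReal_mul (by positivity), dirichletCoeff,
    ← hD]
  constructor
  · refine ENNReal.ofReal_le_ofReal ?_
    rw [div_mul_eq_mul_div, div_le_iff₀ (by positivity)]
    calc κ * 2 ^ m * (p * D / p !) = κ * 2 ^ m * D * (p / p !) := by ring
      _ ≤ κ * 2 ^ m * D * ((2 * m : ℝ) ^ (2 * m - 1) *
          ((p * (p + n - 2) : ℝ) ^ m / (p + (2 * m - 1))!)) := by gcongr
      _ = _ := by ring
  · refine ENNReal.ofReal_le_ofReal ?_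
    calc _ ≤ κ * 2 ^ m * D * ((n : ℝ) ^ m * (p / p !)) := by gcongr
      _ = _ := by ring

end Weights

/-! ### Seminorms from weighted sums -/

section Seminorm

variable {n : ℕ}

/-- Optimizing at `ε = √b / √a` turns the right side into `(√a + √b)²`. This recovers the triangle
inequality from a family of inequalities that can be integrated and summed in `[0, ∞]`. -/
lemma sqrt_le_sqrt_add_sqrt {a b c : ℝ} (ha : 0 ≤ a) (hb : 0 ≤ b)
    (h : ∀ ε : ℝ, 0 < ε → c ≤ (1 + ε) * a + (1 + ε⁻¹) * b) : √c ≤ √a + √b := by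
  refine le_of_forall_pos_le_add fun δ hδ => ?_
  -- The shift by `δ / 2` keeps the quotient `y / x` positive when `a` or `b` is zero.
  obtain ⟨x, hx⟩ : ∃ x, x = √a + δ / 2 := ⟨_, rfl⟩
  obtain ⟨y, hy⟩ : ∃ y, y = √b + δ / 2 := ⟨_, rfl⟩
  have hx0 : 0 < x := by rw [hx]; positivity
  have hy0 : 0 < y := by rw [hy]; positivity
  have hxy : √a + √b + δ = x + y := by rw [hx, hy]; ring
  have h1 : a ≤ x ^ 2 := by
    nlinarith [Real.sq_sqrt ha, Real.sqrt_nonneg a, mul_nonneg (Real.sqrt_nonneg a) hδ.le]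
  have h2 : b ≤ y ^ 2 := by
    nlinarith [Real.sq_sqrt hb, Real.sqrt_nonneg b, mul_nonneg (Real.sqrt_nonneg b) hδ.le]
  refine Real.sqrt_le_iff.2 ⟨by positivity, (h _ (div_pos hy0 hx0)).trans ?_⟩
  calc (1 + y / x) * a + (1 + (y / x)⁻¹) * b
      ≤ (1 + y / x) * x ^ 2 + (1 + (y / x)⁻¹) * y ^ 2 := by gcongr
    _ = _ := by rw [hxy]; field_simp; ring

lemma enorm_add_sq_le {ε : ℝ} (hε : 0 < ε) (a b : ℂ) :
    ‖a + b‖ₑ ^ 2 ≤ ENNReal.ofReal (1 + ε) * ‖a‖ₑ ^ 2 + ENNReal.ofReal (1 + ε⁻¹) * ‖b‖ₑ ^ 2 := by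
  simp only [← ofReal_norm, ← ENNReal.ofReal_pow (norm_nonneg _)]
  rw [← ENNReal.ofReal_mul (by positivity), ← ENNReal.ofReal_mul (by positivity),
    ← ENNReal.ofReal_add (by positivity) (by positivity)]
  refine ENNReal.ofReal_le_ofReal ?_
  have h : 2 * ‖a‖ * ‖b‖ ≤ ε * ‖a‖ ^ 2 + ε⁻¹ * ‖b‖ ^ 2 := by
    have := mul_nonneg (inv_nonneg.2 hε.le) (sq_nonneg (ε * ‖a‖ - ‖b‖))
    have e : ε⁻¹ * (ε * ‖a‖ - ‖b‖) ^ 2 = ε * ‖a‖ ^ 2 - 2 * ‖a‖ * ‖b‖ + ε⁻¹ * ‖b‖ ^ 2 := by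
      field_simp; ring
    linarith
  nlinarith [pow_le_pow_left₀ (norm_nonneg _) (norm_add_le a b) 2]

lemma sphereNormSq_add_le {F G : E n → ℂ} (hF : Continuous F) {ε : ℝ} (hε : 0 < ε) :
    sphereNormSq n (F + G) ≤
      ENNReal.ofReal (1 + ε) * sphereNormSq n F + ENNReal.ofReal (1 + ε⁻¹) * sphereNormSq n G := by
  unfold sphereNormSq
  have hm : Measurable fun ζ : sphere (0 : E n) 1 => ‖F ζ‖ₑ ^ 2 := by
    have := hF.measurable
    fun_prop
  rw [← lintegral_const_mul _ hm, ← lintegral_const_mul' _ _ ENNReal.ofReal_ne_top,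
    ← lintegral_add_left (hm.const_mul _)]
  exact lintegral_mono fun ζ => enorm_add_sq_le hε _ _

lemma sphereNormSq_smul (c : ℂ) (F : E n → ℂ) :
    sphereNormSq n (c • F) = ENNReal.ofReal (‖c‖ ^ 2) * sphereNormSq n F := by
  unfold sphereNormSq
  rw [← lintegral_const_mul' _ _ ENNReal.ofReal_ne_top]
  refine lintegral_congr fun ζ => ?_
  simp only [Pi.smul_apply, smul_eq_mul, enorm_mul, mul_pow]
  rw [ENNReal.ofReal_pow (norm_nonneg _), ofReal_norm]

lemma IsSolidHarmonic.continuous {p : ℕ} {F : E n → ℂ} (hF : IsSolidHarmonic n p F) :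
    Continuous F :=
  continuous_iff_continuousAt.2 fun x => (hF.2 x (Set.mem_univ x)).1.continuousAt

lemma harmonicOnNhd_const_smul {f : E n → ℂ} {s : Set (E n)} (hf : HarmonicOnNhd f s) (c : ℂ) :
    HarmonicOnNhd (c • f) s := fun x hx =>
  ⟨(hf x hx).1.const_smul c, by
    have h1 := (hf x hx).1.eventually (by simp)
    filter_upwards [(hf x hx).2, h1] with y hy hy1
    rw [laplacian_smul c hy1, hy]
    simp⟩

/-- The quadratic form `∑ₚ wₚ ‖f_p‖²` attached to a sequence of weights, with values
in `[0, ∞]`. -/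
def weightedNormSq (n : ℕ) (w : ℕ → ℝ≥0∞) (f : E n → ℂ) : ℝ≥0∞ :=
  ∑' p, w p * sphereNormSq n (component n f p)

lemma weightedNormSq_le_of_le {w v : ℕ → ℝ≥0∞} {c : ℝ≥0∞} (h : ∀ p, w p ≤ c * v p) (f : E n → ℂ) :
    weightedNormSq n w f ≤ c * weightedNormSq n v f := by
  unfold weightedNormSq
  rw [← ENNReal.tsum_mul_left]
  refine ENNReal.tsum_le_tsum fun p => ?_
  rw [← mul_assoc]
  gcongr
  exact h p

variable [hn : Fact (2 ≤ n)] {f g : E n → ℂ}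

lemma weightedNormSq_add_le (w : ℕ → ℝ≥0∞) (hf : HarmonicOnNhd f (ball 0 1))
    (hg : HarmonicOnNhd g (ball 0 1)) {ε : ℝ} (hε : 0 < ε) :
    weightedNormSq n w (f + g) ≤ ENNReal.ofReal (1 + ε) * weightedNormSq n w f +
      ENNReal.ofReal (1 + ε⁻¹) * weightedNormSq n w g := by
  have hF := isHarmonicExpansion_component hf
  have hG := isHarmonicExpansion_component hg
  unfold weightedNormSq
  rw [(hF.add hG).component_eq, ← ENNReal.tsum_mul_left, ← ENNReal.tsum_mul_left,
    ← ENNReal.tsum_add]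
  refine ENNReal.tsum_le_tsum fun p => ?_
  rw [Pi.add_apply, mul_left_comm, mul_left_comm (ENNReal.ofReal (1 + ε⁻¹)), ← mul_add]
  gcongr
  exact sphereNormSq_add_le (hF.solid p).continuous hε

lemma weightedNormSq_smul (w : ℕ → ℝ≥0∞) (hf : HarmonicOnNhd f (ball 0 1)) (c : ℂ) :
    weightedNormSq n w (c • f) = ENNReal.ofReal (‖c‖ ^ 2) * weightedNormSq n w f := by
  unfold weightedNormSq
  rw [((isHarmonicExpansion_component hf).smul c).component_eq, ← ENNReal.tsum_mul_left]
  refine tsum_congr fun p => ?_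
  rw [Pi.smul_apply, sphereNormSq_smul, mul_left_comm]

variable (n) in
/-- The harmonic Dirichlet space as a complex vector space. -/
def harmonicDirichletSubmodule : Submodule ℂ (E n → ℂ) where
  carrier := harmonicDirichletSpace n
  add_mem' := fun {f g} hf hg => ⟨hf.1.add hg.1,
    (weightedNormSq_add_le _ hf.1 hg.1 one_pos).trans_lt <| ENNReal.add_lt_top.2
      ⟨ENNReal.mul_lt_top ENNReal.ofReal_lt_top hf.2,
        ENNReal.mul_lt_top ENNReal.ofReal_lt_top hg.2⟩⟩
  smul_mem' := fun c f hf => ⟨harmonicOnNhd_const_smul hf.1 c,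
    (weightedNormSq_smul _ hf.1 c).trans_lt <| ENNReal.mul_lt_top ENNReal.ofReal_lt_top hf.2⟩
  zero_mem' := by
    have h0 : HarmonicOnNhd (0 : E n → ℂ) (ball 0 1) := fun _ _ => harmonicAt_const 0
    refine ⟨h0, ?_⟩
    -- Writing zero as `0 • 0` avoids computing its components.
    have := weightedNormSq_smul (fun p => ENNReal.ofReal (dirichletCoeff n p)) h0 0
    rw [zero_smul, norm_zero, zero_pow two_ne_zero, ENNReal.ofReal_zero, zero_mul] at this
    exact this.trans_lt ENNReal.zero_lt_top

/-- The seminorm `(∑ₚ wₚ ‖f_p‖²)^(1/2)` on the harmonic Dirichlet space. -/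
def weightedSeminorm (w : ℕ → ℝ≥0∞)
    (hw : ∀ f ∈ harmonicDirichletSubmodule n, weightedNormSq n w f < ∞) :
    Seminorm ℂ (harmonicDirichletSubmodule n) :=
  Seminorm.of (fun f => √(weightedNormSq n w f).toReal)
    (fun f g => by
      refine sqrt_le_sqrt_add_sqrt ENNReal.toReal_nonneg ENNReal.toReal_nonneg fun ε hε => ?_
      have hf := (hw f f.2).ne
      have hg := (hw g g.2).ne
      have h := ENNReal.toReal_mono (by finiteness) (weightedNormSq_add_le w f.2.1 g.2.1 hε)
      rwa [ENNReal.toReal_add (by finiteness) (by finiteness), ENNReal.toReal_mul,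
        ENNReal.toReal_mul, ENNReal.toReal_ofReal (by positivity),
        ENNReal.toReal_ofReal (by positivity)] at h)
    (fun c f => by
      have h := weightedNormSq_smul w f.2.1 c
      rw [Submodule.coe_smul, h, ENNReal.toReal_mul, ENNReal.toReal_ofReal (by positivity),
        Real.sqrt_mul (by positivity), Real.sqrt_sq (norm_nonneg c)])

/-- Termwise comparison of weights. No finiteness is assumed, so it also transfers finiteness in
both directions. -/
lemma exists_tangentialNormSq_bounds {m : ℕ} (hm : (n : ℝ) / 4 < m) :
    ∃ c C : ℝ, 0 < c ∧ 0 < C ∧ ∀ f : E n → ℂ, HarmonicOnNhd f (ball 0 1) →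
      ENNReal.ofReal c * dirichletNormSq n f ≤ tangentialNormSq n m f ∧
      tangentialNormSq n m f ≤ ENNReal.ofReal C * dirichletNormSq n f := by
  obtain ⟨c, C, hc, hC, h⟩ := exists_tangentialWeight_bounds (n := n) hm
  refine ⟨c, C, hc, hC, fun f hf => ?_⟩
  rw [tangentialNormSq_eq_tsum hf]
  refine ⟨?_, weightedNormSq_le_of_le (fun p => (h p).2) f⟩
  unfold dirichletNormSq
  rw [← ENNReal.tsum_mul_left]
  refine ENNReal.tsum_le_tsum fun p => ?_
  rw [← mul_assoc]
  gcongr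
  exact (h p).1

lemma mem_harmonicDirichletSpace_iff (hf : HarmonicOnNhd f (ball 0 1)) {m : ℕ}
    (hm : (n : ℝ) / 4 < m) : f ∈ harmonicDirichletSpace n ↔ tangentialNormSq n m f < ∞ := by
  obtain ⟨c, C, hc, -, h⟩ := exists_tangentialNormSq_bounds hm
  refine ⟨fun hf' => (h f hf).2.trans_lt (ENNReal.mul_lt_top ENNReal.ofReal_lt_top hf'.2),
    fun hf' => ⟨hf, ?_⟩⟩
  refine ENNReal.lt_top_of_mul_ne_top_right ((h f hf).1.trans_lt hf').ne ?_
  simpa using hc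

end Seminorm

end HarmonicDirichlet

end

/-! ### The main theorem -/

open HarmonicDirichlet in
theorem mainTheorem8 (n : ℕ) (hn : 2 ≤ n) :
    (∀ f : E n → ℂ, HarmonicOnNhd f (ball (0 : E n) 1) →
      (∃! F : ℕ → E n → ℂ, IsHarmonicExpansion n f F) ∧
      (f ∈ harmonicDirichletSpace n ↔
        ∃ m : ℕ, (n : ℝ) / 4 < (m : ℝ) ∧ tangentialNormSq n m f < ∞) ∧
      (f ∈ harmonicDirichletSpace n ↔
        ∀ m : ℕ, (n : ℝ) / 4 < (m : ℝ) → tangentialNormSq n m f < ∞)) ∧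
    ∃ V : Submodule ℂ (E n → ℂ), (V : Set (E n → ℂ)) = harmonicDirichletSpace n ∧
      ∃ q₀ : Seminorm ℂ V,
        (∀ f : V, q₀ f = Real.sqrt (dirichletNormSq n (f : E n → ℂ)).toReal) ∧
        ∀ m : ℕ, (n : ℝ) / 4 < (m : ℝ) →
          ∃ q : Seminorm ℂ V,
            (∀ f : V, q f = Real.sqrt (tangentialNormSq n m (f : E n → ℂ)).toReal) ∧
            ∃ c C : ℝ, 0 < c ∧ 0 < C ∧ ∀ f : V, c * q₀ f ≤ q f ∧ q f ≤ C * q₀ f := by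
  have := Fact.mk hn
  -- `m = n` is admissible: it witnesses the existential condition and keeps the universal one from
  -- being vacuous.
  have hn4 : (n : ℝ) / 4 < n := by
    have : (2 : ℝ) ≤ n := by exact_mod_cast hn
    linarith
  -- `dirichletNormSq` unfolds to `weightedNormSq` with the Dirichlet coefficients, so the formula
  -- for `q₀` holds by definition.
  refine ⟨fun f hf => ⟨?_, ?_, ?_⟩, harmonicDirichletSubmodule n, rfl,
    weightedSeminorm _ fun f hf => hf.2, fun f => rfl, fun m hm => ?_⟩
  · obtain ⟨F, hF⟩ := exists_isHarmonicExpansion hf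
    exact ⟨F, hF, fun G hG => hG.unique hF⟩
  · exact ⟨fun h => ⟨n, hn4, (mem_harmonicDirichletSpace_iff hf hn4).1 h⟩,
      fun ⟨m, hm, h⟩ => (mem_harmonicDirichletSpace_iff hf hm).2 h⟩
  · exact ⟨fun h m hm => (mem_harmonicDirichletSpace_iff hf hm).1 h,
      fun h => (mem_harmonicDirichletSpace_iff hf hn4).2 (h n hn4)⟩
  · have hq : ∀ f : harmonicDirichletSubmodule n,
        weightedNormSq n (tangentialWeight n m) f = tangentialNormSq n m f := fun f =>
      (tangentialNormSq_eq_tsum f.2.1 m).symm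
    have htop : ∀ f : harmonicDirichletSubmodule n, tangentialNormSq n m f < ∞ := fun f =>
      (mem_harmonicDirichletSpace_iff f.2.1 hm).1 f.2
    obtain ⟨c, C, hc, hC, h⟩ := exists_tangentialNormSq_bounds (n := n) hm
    refine ⟨weightedSeminorm (tangentialWeight n m) fun f hf => (hq ⟨f, hf⟩).trans_lt (htop ⟨f, hf⟩),
      fun f => congrArg (fun a => √(ENNReal.toReal a)) (hq f),
      √c, √C, Real.sqrt_pos.2 hc, Real.sqrt_pos.2 hC, fun f => ?_⟩
    change √c * √(dirichletNormSq n f).toReal ≤ √(weightedNormSq n _ f).toReal ∧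
      √(weightedNormSq n _ f).toReal ≤ √C * √(dirichletNormSq n f).toReal
    rw [hq, ← Real.sqrt_mul hc.le, ← Real.sqrt_mul hC.le]
    obtain ⟨h1, h2⟩ := h f f.2.1
    have hfin : dirichletNormSq n (f : E n → ℂ) ≠ ∞ := f.2.2.ne
    constructor
    · refine Real.sqrt_le_sqrt ?_
      have := ENNReal.toReal_mono (htop f).ne h1
      rwa [ENNReal.toReal_mul, ENNReal.toReal_ofReal hc.le] at this
    · refine Real.sqrt_le_sqrt ?_
      have := ENNReal.toReal_mono (ENNReal.mul_ne_top ENNReal.ofReal_ne_top hfin) h2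
      rwa [ENNReal.toReal_mul, ENNReal.toReal_ofReal hC.le] at this
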